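/- Let $(W,S)$ be a Coxeter system with $W$ finite, let $Q=(q_1,\dots,q_r)$ be a word in the generators $S$ and let $\pi\in W$. The subword complex $\Delta(Q,\pi)$ is the simplicial complex on $[r]=\{1,\dots,r\}$ whose facets are the sets $F\subseteq[r]$ such that the subword of $Q$ formed by the letters at the positions in $[r]\setminus F$ is a reduced expression of $\pi$. Suppose that $\Delta(Q,\pi)$ is spherical, that is, its geometric realization is homeomorphic to a sphere, and let $I$ be a non-empty face of $\Delta(Q,\pi)$. Then the costar of $I$ in $\Delta(Q,\pi)$, i.e. the simplicial complex generated by the facets of $\Delta(Q,\pi)$ that do not contain $I$, is vertex decomposable. Here a simplicial complex $\Delta$ is called vertex decomposable if it is a simplex (possibly empty), or if it is pure and has a vertex $v$ such that both the deletion $\{J\in\Delta : v\notin J\}$ and the link $\{J\in\Delta : v\notin J,\ J\cup\{v\}\in\Delta\}$ are vertex decomposable. -/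

import Mathlib

/-- A simplicial complex on the ground set `V`: a family of finite subsets of `V` (the faces),
closed under taking subsets. The empty set is a face of every complex that has a face, and
elements of `V` need not be vertices. -/
abbrev SimplicialCx (V : Type*) := LowerSet (Finset V)

namespace SimplicialCx

/-- The facets of `Δ`: the inclusion-maximal faces. -/
def facets {V : Type*} (Δ : SimplicialCx V) : Set (Finset V) :=
  {F | Maximal (fun J : Finset V => J ∈ Δ) F}

/-- `Δ` is pure: all facets have the same dimension. -/
def IsPure {V : Type*} (Δ : SimplicialCx V) : Prop :=
  ∀ F ∈ Δ.facets, ∀ G ∈ Δ.facets, F.card = G.card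

/-- The deletion of `I` in `Δ`: the faces that do not contain `I`. -/
def deletion {V : Type*} (Δ : SimplicialCx V) (I : Finset V) : SimplicialCx V where
  carrier := {J | J ∈ Δ ∧ ¬ I ⊆ J}
  lower' := fun _ _ hba ha => ⟨Δ.lower hba ha.1, fun h => ha.2 (h.trans hba)⟩

/-- The link of `I` in `Δ`: the faces `J` disjoint from `I` such that `I ∪ J` is a face. -/
def link {V : Type*} [DecidableEq V] (Δ : SimplicialCx V) (I : Finset V) : SimplicialCx V where
  carrier := {J | I ∪ J ∈ Δ ∧ I ∩ J = ∅}
  lower' := fun _ _ hba ha =>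
    ⟨Δ.lower (Finset.union_subset_union_right hba) ha.1,
      Finset.subset_empty.mp (ha.2 ▸ Finset.inter_subset_inter_left hba)⟩

/-- The costar of `I` in `Δ`: the complex generated by the facets not containing `I`. -/
def costar {V : Type*} (Δ : SimplicialCx V) (I : Finset V) : SimplicialCx V where
  carrier := {J | ∃ F ∈ Δ.facets, J ⊆ F ∧ ¬ I ⊆ F}
  lower' := fun _ _ hba ⟨F, hF, haF, hI⟩ => ⟨F, hF, Finset.Subset.trans hba haF, hI⟩

/-- `Δ` is a simplex: it consists of all subsets of one finite set. By convention the complex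
without faces is a simplex as well. -/
def IsSimplex {V : Type*} (Δ : SimplicialCx V) : Prop :=
  (∀ J, J ∉ Δ) ∨ ∃ F : Finset V, ∀ J, J ∈ Δ ↔ J ⊆ F

/-- `Δ` is vertex decomposable: it is a simplex, or it is pure and has a vertex whose deletion and
whose link are both vertex decomposable. -/
inductive VertexDecomposable {V : Type*} [DecidableEq V] : SimplicialCx V → Prop
  | simplex (Δ : SimplicialCx V) (h : Δ.IsSimplex) : VertexDecomposable Δ
  | vertex (Δ : SimplicialCx V) (hpure : Δ.IsPure) (v : V) (hv : {v} ∈ Δ)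
      (hdel : VertexDecomposable (Δ.deletion {v}))
      (hlink : VertexDecomposable (Δ.link {v})) : VertexDecomposable Δ

/-- The standard geometric realization of `Δ` in `ℝ^V` for a finite ground set `V`: the union over
the faces `I` of the convex hulls of the standard basis vectors indexed by `I`. -/
def realization {V : Type*} [Fintype V] [DecidableEq V] (Δ : SimplicialCx V) : Set (V → ℝ) :=
  ⋃ I ∈ Δ, convexHull ℝ ((fun i : V => (Pi.single i 1 : V → ℝ)) '' (I : Set V))

/-- `Δ` is spherical: its geometric realization is homeomorphic to the unit sphere of some `ℝ^d`
(of dimension `d - 1`; it is empty for `d = 0`). -/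
def IsSpherical {V : Type*} [Fintype V] [DecidableEq V] (Δ : SimplicialCx V) : Prop :=
  ∃ d : ℕ, Nonempty (Δ.realization ≃ₜ Metric.sphere (0 : EuclideanSpace ℝ (Fin d)) 1)

end SimplicialCx

/-- The subword `Q_J` of `Q = (q_1, …, q_r)`: the letters with positions in `J`, in order. -/
def subword {B : Type*} {r : ℕ} (Q : Fin r → B) (J : Finset (Fin r)) : List B :=
  ((List.finRange r).filter (fun i => i ∈ J)).map Q

/-- The word `w` is a reduced expression of the group element `x`. -/
def IsReducedExpression {B W : Type*} [Group W] {M : CoxeterMatrix B} (cs : CoxeterSystem M W)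
    (w : List B) (x : W) : Prop :=
  cs.IsReduced w ∧ cs.wordProd w = x

/-- The subword complex `Δ(Q, x)` on the positions of the word `Q`, whose facets are the sets `F`
of positions such that the subword of `Q` on the complement of `F` is a reduced expression of `x`.
These sets all have the same size, so none contains another, and the faces are their subsets. -/
def subwordComplex {B W : Type*} [Group W] {M : CoxeterMatrix B} (cs : CoxeterSystem M W)
    {r : ℕ} (Q : Fin r → B) (x : W) : SimplicialCx (Fin r) where
  carrier := {J | ∃ F : Finset (Fin r), J ⊆ F ∧ IsReducedExpression cs (subword Q Fᶜ) x}
  lower' := fun _ _ hba ⟨F, haF, hF⟩ => ⟨F, Finset.Subset.trans hba haF, hF⟩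

/-!
Let `x` be the group element and `L` the list of positions of the word `Q`.

*Sphericity determines the Demazure product.* Splitting off the first letter `v` of the word writes
the subword complex as the union of its deletion and of the cone over its link at `v`, and both are
subword complexes of the shorter word. If the Demazure product of the word is not `x`, this
recursion shows that the realization is an absolute extensor
(`tietzeExtension_realization_listComplex`): absolute extensors can be glued along absolute
extensors (`TietzeExtension.union`), and a letter that does not shorten `x` is the apex of a cone,
which is a union of simplices with a common vertex. A sphere is not an absolute extensor, because
it is not a retract of Euclidean space (`not_exists_retraction_sphere`). So a spherical subword
complex with a face has Demazure product `x`.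

*The deletion of a vertex.* A subword complex is vertex decomposable along its first letter, and its
facets all have `|L| - ℓ(x)` elements. The deletion of an arbitrary vertex is the complex of a word
in which that letter is frozen, that is, always present. In a word `A ρ C` with frozen factor `ρ`,
deleting the first letter of `C` adds this letter to `ρ`, and its link just drops it from `C`. With
`C` used up, the frozen factor at the end can be divided out of `x`, which leaves a subword complex.
Purity is the point where the Demazure product of `A ρ C` has to be `x`: then a subword contains
`x` exactly if its Demazure product is `x` (`CoxeterSystem.wordContains_iff_demazureProd_eq`), so
that the complex depends only on the Demazure product of `ρ`, and a letter of `C` that `ρ` absorbs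
is the apex of a cone (`pureVertexDecomposable_factorComplex`).

*The costar.* All facets of the complex and of its deletion `Δ.deletion I` have the same size, so
the costar of `I` is this deletion (`SimplicialCx.costar_eq_deletion`). For `v ∈ I` its deletion at
`v` is the deletion of the vertex `v` from `Δ`, and its link at `v` is the deletion of `I ∖ {v}` from
the link of `v`, so that induction on the size of `I` concludes
(`pureVertexDecomposable_deletion_listComplex`).

The facts on Coxeter groups rest on the strong exchange property, which follows from the action of
the group on pairs of an element and a sign.
-/

/-! ### The strong exchange property -/

namespace CoxeterSystem

variable {B W : Type*} [Group W] {M : CoxeterMatrix B} (cs : CoxeterSystem M W)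

open Classical in
/-- The permutation of `W × ℤ/2` attached to a simple reflection `s`: it conjugates the first
component by `s` and changes the sign exactly when the first component is `s`. -/
noncomputable def signedConj (i : B) : Equiv.Perm (W × ZMod 2) :=
  Function.Involutive.toPerm
    (fun p => (cs.simple i * p.1 * cs.simple i, p.2 + if p.1 = cs.simple i then 1 else 0)) (by
      rintro ⟨t, e⟩
      have h : cs.simple i * t * cs.simple i = cs.simple i ↔ t = cs.simple i := by
        constructor
        · intro h
          have := congrArg (fun x => cs.simple i * x * cs.simple i) h
          simpa [mul_assoc] using this
        · rintro rfl; simp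
      simp only [h, Prod.mk.injEq]
      refine ⟨by simp [mul_assoc], ?_⟩
      rw [add_assoc, CharTwo.add_self_eq_zero, add_zero])

open Classical in
theorem signedConj_apply (i : B) (t : W) (e : ZMod 2) :
    cs.signedConj i (t, e) =
      (cs.simple i * t * cs.simple i, e + if t = cs.simple i then 1 else 0) := rfl

open Classical in
theorem signedConj_mul_pow_apply (i j : B) (n : ℕ) (t : W) (e : ZMod 2) :
    ((cs.signedConj i * cs.signedConj j) ^ n) (t, e) =
      ((cs.simple i * cs.simple j) ^ n * t * ((cs.simple i * cs.simple j) ^ n)⁻¹,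
        e + ∑ k ∈ Finset.range (2 * n),
          if t = (cs.simple j * cs.simple i) ^ k * cs.simple j then 1 else 0) := by
  induction n generalizing t e with
  | zero => simp
  | succ n ih =>
    rw [pow_succ, Equiv.Perm.mul_apply, Equiv.Perm.mul_apply, signedConj_apply, signedConj_apply,
      ih]
    have h1 : cs.simple j * t * cs.simple j = cs.simple i ↔
        t = (cs.simple j * cs.simple i) ^ 1 * cs.simple j := by
      constructor
      · intro h
        have := congrArg (fun x => cs.simple j * x * cs.simple j) h
        simpa [mul_assoc] using this
      · rintro rfl; simp [mul_assoc]
    have h2 : ∀ k, cs.simple i * (cs.simple j * t * cs.simple j) * cs.simple i =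
        (cs.simple j * cs.simple i) ^ k * cs.simple j ↔
        t = (cs.simple j * cs.simple i) ^ (k + 2) * cs.simple j := by
      intro k
      have e : (cs.simple j * cs.simple i) ^ (k + 2) * cs.simple j =
          cs.simple j * (cs.simple i * ((cs.simple j * cs.simple i) ^ k * cs.simple j) *
            cs.simple i) * cs.simple j := by
        have : (cs.simple j * cs.simple i) ^ (k + 2) =
          (cs.simple j * cs.simple i) * (cs.simple j * cs.simple i) ^ k *
            (cs.simple j * cs.simple i) := by
          rw [← pow_succ', ← pow_succ]
        rw [this]; simp only [mul_assoc]
      rw [e]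
      constructor
      · intro h; rw [← h]; simp [mul_assoc]
      · intro h; rw [h]; simp [mul_assoc]
    simp only [h1, h2]
    rw [show 2 * (n + 1) = 2 * n + 1 + 1 by ring, Finset.sum_range_succ', Finset.sum_range_succ']
    refine Prod.ext ?_ ?_
    · simp [mul_assoc, pow_succ]
    · simp only [pow_zero, one_mul, zero_add]
      ring

theorem isLiftable_signedConj : M.IsLiftable cs.signedConj := by
  classical
  intro i j
  ext1 ⟨t, e⟩
  rw [signedConj_mul_pow_apply, Equiv.Perm.one_apply]
  have h1 : (cs.simple j * cs.simple i) ^ M i j = 1 := cs.simple_mul_simple_pow' i j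
  rw [two_mul, Finset.sum_range_add]
  simp only [pow_add, h1, one_mul]
  rw [CharTwo.add_self_eq_zero, cs.simple_mul_simple_pow i j]
  simp

/-- The action of `W` on `W × ℤ/2` by signed conjugation. -/
noncomputable def signedConjHom : W →* Equiv.Perm (W × ZMod 2) :=
  cs.lift ⟨cs.signedConj, cs.isLiftable_signedConj⟩

/-- The sign records the parity of the multiplicity of `t` in the right inversion sequence; as the
left-hand side depends on the product of `ω` only, so does this parity. -/
theorem signedConjHom_wordProd_apply [DecidableEq W] (ω : List B) (t : W) (e : ZMod 2) :
    cs.signedConjHom (cs.wordProd ω) (t, e) =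
      (cs.wordProd ω * t * (cs.wordProd ω)⁻¹, e + ((cs.rightInvSeq ω).count t : ℕ)) := by
  induction ω with
  | nil => simp
  | cons i ω ih =>
    rw [wordProd_cons, map_mul, Equiv.Perm.mul_apply, ih]
    have : cs.signedConjHom (cs.simple i) = cs.signedConj i := cs.lift_apply_simple _ i
    rw [this, signedConj_apply, rightInvSeq, List.count_cons]
    have h : cs.wordProd ω * t * (cs.wordProd ω)⁻¹ = cs.simple i ↔
        (cs.wordProd ω)⁻¹ * cs.simple i * cs.wordProd ω = t := by
      rw [mul_inv_eq_iff_eq_mul, mul_assoc, inv_mul_eq_iff_eq_mul, eq_comm]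
    refine Prod.ext ?_ ?_
    · simp [mul_assoc]
    · simp only [h, beq_iff_eq]
      push_cast
      split_ifs <;> ring

theorem signedConjHom_snd_add (w t : W) (e : ZMod 2) :
    (cs.signedConjHom w (t, e)).2 = e + (cs.signedConjHom w (t, 0)).2 := by
  classical
  obtain ⟨ω, -, rfl⟩ := cs.exists_isReduced w
  simp [signedConjHom_wordProd_apply]

theorem signedConjHom_fst (w t : W) (e : ZMod 2) :
    (cs.signedConjHom w (t, e)).1 = w * t * w⁻¹ := by
  classical
  obtain ⟨ω, -, rfl⟩ := cs.exists_isReduced w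
  simp [signedConjHom_wordProd_apply]

theorem IsReflection.signedConjHom_self {cs : CoxeterSystem M W} {t : W}
    (ht : cs.IsReflection t) (e : ZMod 2) : cs.signedConjHom t (t, e) = (t, e + 1) := by
  obtain ⟨u, i, rfl⟩ := ht
  have hs (e) : cs.signedConjHom (cs.simple i) (cs.simple i, e) = (cs.simple i, e + 1) := by
    rw [show cs.signedConjHom (cs.simple i) = cs.signedConj i from cs.lift_apply_simple _ i,
      signedConj_apply]
    simp
  obtain ⟨c, hc⟩ : ∃ c, cs.signedConjHom u⁻¹ (u * cs.simple i * u⁻¹, e) = (cs.simple i, c) :=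
    ⟨_, Prod.ext (by rw [signedConjHom_fst]; simp [mul_assoc]) rfl⟩
  have hc' : cs.signedConjHom u (cs.simple i, c) = (u * cs.simple i * u⁻¹, e) := by
    rw [← hc, ← Equiv.Perm.mul_apply, ← map_mul]; simp
  rw [map_mul, map_mul, Equiv.Perm.mul_apply, Equiv.Perm.mul_apply, hc, hs]
  refine Prod.ext (cs.signedConjHom_fst _ _ _) ?_
  have := congrArg Prod.snd hc'
  rw [signedConjHom_snd_add] at this ⊢
  simp only at this ⊢
  rw [← this]; ring

/-- Multiplication by `t` changes the parity of the multiplicity of `t`. If the multiplicity were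
zero in `ω`, then `t` would occur in a reduced word for `wordProd ω * t`, so that `t` would shorten
this element as well. -/
theorem IsReflection.mem_rightInvSeq_of_length_lt {cs : CoxeterSystem M W} {t : W}
    (ht : cs.IsReflection t) {ω : List B}
    (h : cs.length (cs.wordProd ω * t) < cs.length (cs.wordProd ω)) : t ∈ cs.rightInvSeq ω := by
  classical
  by_contra hmem
  obtain ⟨ω', hω', he⟩ := cs.exists_isReduced (cs.wordProd ω * t)
  have h1 : cs.signedConjHom (cs.wordProd ω * t) (t, 0) =
      (cs.wordProd ω * t * (cs.wordProd ω)⁻¹, 1) := by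
    rw [map_mul, Equiv.Perm.mul_apply, ht.signedConjHom_self, signedConjHom_wordProd_apply,
      List.count_eq_zero_of_not_mem hmem]
    simp
  have h2 : t ∈ cs.rightInvSeq ω' := by
    by_contra hmem'
    rw [he, signedConjHom_wordProd_apply, List.count_eq_zero_of_not_mem hmem'] at h1
    simpa using congrArg Prod.snd h1
  have h3 := (cs.isRightInversion_of_mem_rightInvSeq hω' h2).2
  rw [← he, mul_assoc, ht.mul_self, mul_one] at h3
  omega

/-- **Strong exchange property**, for multiplication on the right. -/
theorem IsReflection.exists_eraseIdx_eq_mul {cs : CoxeterSystem M W} {t : W}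
    (ht : cs.IsReflection t) {ω : List B}
    (h : cs.length (cs.wordProd ω * t) < cs.length (cs.wordProd ω)) :
    ∃ j < ω.length, cs.wordProd (ω.eraseIdx j) = cs.wordProd ω * t := by
  obtain ⟨j, hj, hjt⟩ := List.getElem_of_mem (ht.mem_rightInvSeq_of_length_lt h)
  rw [length_rightInvSeq] at hj
  refine ⟨j, hj, ?_⟩
  rw [← cs.wordProd_mul_getD_rightInvSeq ω j, List.getD_eq_getElem _ _ (by simpa using hj), hjt]

/-- **Strong exchange property**, for multiplication on the left. -/
theorem IsReflection.exists_eraseIdx_eq_mul_left {cs : CoxeterSystem M W} {t : W}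
    (ht : cs.IsReflection t) {ω : List B}
    (h : cs.length (t * cs.wordProd ω) < cs.length (cs.wordProd ω)) :
    ∃ j < ω.length, cs.wordProd (ω.eraseIdx j) = t * cs.wordProd ω := by
  have e : t * cs.wordProd ω = cs.wordProd ω * ((cs.wordProd ω)⁻¹ * t * cs.wordProd ω) := by
    group
  rw [e] at h ⊢
  refine IsReflection.exists_eraseIdx_eq_mul ?_ h
  simpa using ht.conj (cs.wordProd ω)⁻¹

end CoxeterSystem

/-! ### Demazure products -/

namespace CoxeterSystem

variable {B W : Type*} [Group W] {M : CoxeterMatrix B} (cs : CoxeterSystem M W)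

/-- The exchange condition in the form that compares left and right multiplication. -/
theorem simple_mul_eq_mul_simple_of_length {x : W} {a b : B}
    (h1 : cs.length (cs.simple a * x * cs.simple b) = cs.length x)
    (h2 : cs.length (cs.simple a * x) = cs.length (x * cs.simple b)) :
    cs.simple a * x = x * cs.simple b := by
  have key : ∀ x : W, cs.length (cs.simple a * x * cs.simple b) = cs.length x →
      cs.length (cs.simple a * x) = cs.length (x * cs.simple b) →
      cs.length x < cs.length (cs.simple a * x) → cs.simple a * x = x * cs.simple b := by
    intro x h1 h2 h3
    obtain ⟨ω, hω, rfl⟩ := cs.exists_isReduced x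
    have hlt : cs.length (cs.wordProd (a :: ω) * cs.simple b) <
        cs.length (cs.wordProd (a :: ω)) := by
      rw [wordProd_cons]; omega
    obtain ⟨j, hj, he⟩ := (cs.isReflection_simple b).exists_eraseIdx_eq_mul hlt
    rw [wordProd_cons] at he
    cases j with
    | zero =>
      rw [List.eraseIdx_cons_zero] at he
      nth_rewrite 2 [he]
      simp [mul_assoc]
    | succ j =>
      rw [List.eraseIdx_cons_succ, wordProd_cons, mul_assoc] at he
      have he' := mul_left_cancel he
      have := cs.length_wordProd_le (ω.eraseIdx j)
      have hl := List.length_eraseIdx_add_one (l := ω) (i := j) (by simpa using hj)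
      rw [he'] at this
      have := hω.eq
      omega
  rcases cs.length_simple_mul x a with h | h
  · exact key x h1 h2 (by omega)
  · have hx : cs.simple a * (cs.simple a * x) = x := by simp
    have := key (cs.simple a * x) (by rw [hx]; exact h2.symm) (by rw [hx]; exact h1.symm)
      (by rw [hx]; omega)
    rw [hx] at this
    nth_rewrite 2 [this]
    simp

/-- The longer of `x` and `s * x`, that is, the Demazure product of a simple reflection `s`
and `x`. -/
noncomputable def simpleDemazure (a : B) (x : W) : W :=
  if cs.length (cs.simple a * x) < cs.length x then x else cs.simple a * x

/-- The longer of `x` and `x * s`, that is, the Demazure product of `x` and a simple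
reflection `s`. -/
noncomputable def demazureSimple (x : W) (b : B) : W :=
  if cs.length (x * cs.simple b) < cs.length x then x else x * cs.simple b

/-- The Demazure operators from the left and from the right commute. -/
theorem simpleDemazure_demazureSimple (a b : B) (x : W) :
    cs.simpleDemazure a (cs.demazureSimple x b) = cs.demazureSimple (cs.simpleDemazure a x) b := by
  have h1 := cs.length_simple_mul x a
  have h2 := cs.length_mul_simple x b
  have h3 := cs.length_simple_mul (x * cs.simple b) a
  have h4 := cs.length_mul_simple (cs.simple a * x) b
  have h5 : cs.simple a * (x * cs.simple b) = cs.simple a * x * cs.simple b := by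
    rw [mul_assoc]
  rw [h5] at h3
  have h6 := cs.simple_mul_eq_mul_simple_of_length (x := x) (a := a) (b := b)
  simp only [simpleDemazure, demazureSimple]
  by_cases c1 : cs.length (cs.simple a * x) < cs.length x <;>
  by_cases c2 : cs.length (x * cs.simple b) < cs.length x
  · simp [c1, c2]
  · simp only [c1, c2, if_true, if_false]
    rw [if_pos (by rw [h5]; omega)]
  · simp only [c1, c2, if_true, if_false]
    rw [if_pos (by omega)]
  · simp only [c1, c2, if_false]
    rw [h5]
    by_cases c3 : cs.length (cs.simple a * x * cs.simple b) = cs.length x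
    · rw [if_pos (by omega), if_pos (by omega)]
      exact (h6 c3 (by omega)).symm
    · rw [if_neg (by omega), if_neg (by omega)]

/-- The Demazure product of a word. -/
noncomputable def demazureProd (ω : List B) : W := ω.foldr cs.simpleDemazure 1

@[simp] theorem demazureProd_nil : cs.demazureProd [] = 1 := rfl

@[simp] theorem demazureProd_cons (a : B) (ω : List B) :
    cs.demazureProd (a :: ω) = cs.simpleDemazure a (cs.demazureProd ω) := rfl

theorem demazureProd_append (ω ω' : List B) :
    cs.demazureProd (ω ++ ω') = ω.foldr cs.simpleDemazure (cs.demazureProd ω') := by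
  simp [demazureProd, List.foldr_append]

theorem demazureProd_concat (ω : List B) (b : B) :
    cs.demazureProd (ω ++ [b]) = cs.demazureSimple (cs.demazureProd ω) b := by
  induction ω with
  | nil => simp [simpleDemazure, demazureSimple]
  | cons a ω ih =>
    rw [List.cons_append, demazureProd_cons, ih, simpleDemazure_demazureSimple,
      demazureProd_cons]

/-- In a word, a factor may be replaced by one with the same Demazure product. -/
theorem demazureProd_congr {ρ ρ' : List B} (h : cs.demazureProd ρ = cs.demazureProd ρ')
    (α β : List B) : cs.demazureProd (α ++ ρ ++ β) = cs.demazureProd (α ++ ρ' ++ β) := by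
  induction β using List.reverseRecOn with
  | nil => simp only [List.append_nil, demazureProd_append, h]
  | append_singleton β b ih =>
    rw [← List.append_assoc, ← List.append_assoc, demazureProd_concat, demazureProd_concat, ih]

theorem demazureProd_eq_of_isReduced {ω : List B} (h : cs.IsReduced ω) :
    cs.demazureProd ω = cs.wordProd ω := by
  induction ω with
  | nil => simp
  | cons a ω ih =>
    have hω : cs.IsReduced ω := by simpa using h.drop 1
    rw [demazureProd_cons, ih hω, simpleDemazure, if_neg, wordProd_cons]
    rw [← wordProd_cons, h.eq, hω.eq]
    simp

/-! ### The Bruhat order -/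

/-- The Bruhat order: the reflexive and transitive closure of multiplication by reflections that
increases the length. -/
def BruhatLE : W → W → Prop :=
  Relation.ReflTransGen
    fun u v => ∃ t, cs.IsReflection t ∧ v = t * u ∧ cs.length u < cs.length v

theorem BruhatLE.length_le_and_eq {cs : CoxeterSystem M W} {u v : W} (h : cs.BruhatLE u v) :
    cs.length u ≤ cs.length v ∧ (cs.length u = cs.length v → u = v) := by
  induction h with
  | refl => simp
  | tail h1 h2 ih => obtain ⟨t, -, -, hl⟩ := h2; exact ⟨by omega, by omega⟩

theorem BruhatLE.antisymm {cs : CoxeterSystem M W} {u v : W} (h : cs.BruhatLE u v)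
    (h' : cs.BruhatLE v u) : u = v :=
  h.length_le_and_eq.2 (le_antisymm h.length_le_and_eq.1 h'.length_le_and_eq.1)

theorem bruhatLE_simple_mul {a : B} {u : W} (h : cs.length u < cs.length (cs.simple a * u)) :
    cs.BruhatLE u (cs.simple a * u) :=
  Relation.ReflTransGen.single ⟨_, cs.isReflection_simple a, rfl, h⟩

theorem bruhatLE_simpleDemazure (a : B) (u : W) : cs.BruhatLE u (cs.simpleDemazure a u) := by
  unfold simpleDemazure
  split_ifs with h
  · exact Relation.ReflTransGen.refl
  · exact cs.bruhatLE_simple_mul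
      (lt_of_le_of_ne (not_lt.1 h) (cs.length_simple_mul_ne u a).symm)

/-- The Demazure product is monotone for the Bruhat order. The one case that does not follow from
comparing lengths is settled by the strong exchange property. -/
theorem BruhatLE.simpleDemazure {cs : CoxeterSystem M W} {u v : W} (h : cs.BruhatLE u v) (a : B) :
    cs.BruhatLE (cs.simpleDemazure a u) (cs.simpleDemazure a v) := by
  induction h with
  | refl => exact Relation.ReflTransGen.refl
  | @tail u v h1 h2 ih =>
    refine ih.trans ?_
    clear ih h1
    obtain ⟨t, ht, rfl, hl⟩ := h2
    have hstep : cs.BruhatLE u (t * u) := Relation.ReflTransGen.single ⟨t, ht, rfl, hl⟩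
    have hu := cs.length_simple_mul u a
    have hv := cs.length_simple_mul (t * u) a
    have hconj : cs.IsReflection (cs.simple a * t * cs.simple a) := by
      simpa using ht.conj (cs.simple a)
    have heq : cs.simple a * (t * u) = cs.simple a * t * cs.simple a * (cs.simple a * u) := by
      simp [mul_assoc]
    by_cases c1 : cs.length (cs.simple a * u) < cs.length u
    · rw [show cs.simpleDemazure a u = u by rw [CoxeterSystem.simpleDemazure, if_pos c1]]
      exact hstep.trans (cs.bruhatLE_simpleDemazure a _)
    rw [show cs.simpleDemazure a u = cs.simple a * u by rw [CoxeterSystem.simpleDemazure, if_neg c1]]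
    by_cases c2 : cs.length (cs.simple a * u) < cs.length (cs.simple a * (t * u))
    · exact Relation.ReflTransGen.trans (Relation.ReflTransGen.single ⟨_, hconj, heq, c2⟩)
        (by
          unfold CoxeterSystem.simpleDemazure
          split_ifs with c3
          · have := cs.bruhatLE_simple_mul (a := a) (u := cs.simple a * (t * u)) (by simpa)
            rwa [simple_mul_simple_cancel_left] at this
          · exact Relation.ReflTransGen.refl)
    have hne := hconj.length_mul_right_ne (cs.simple a * u)
    rw [← heq] at hne
    -- The parity of the lengths forces `s * v` to be just as long as `u`, where `v = t * u`. Erasing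
    -- a letter from a reduced word of `v` that starts with `s` gives `u`, and a letter other than
    -- the first would make `s * u` too short.
    have hpar : (cs.length (t * u)) % 2 ≠ cs.length u % 2 := by
      rw [cs.length_mul_mod_two]
      have := ht.odd_length
      rw [Nat.odd_iff] at this
      omega
    have c3 : cs.length (cs.simple a * (t * u)) < cs.length (t * u) := by omega
    rw [CoxeterSystem.simpleDemazure, if_pos c3]
    obtain ⟨ω, hω, he⟩ := cs.exists_isReduced (cs.simple a * (t * u))
    have he' : t * u = cs.wordProd (a :: ω) := by rw [wordProd_cons, ← he]; simp
    have htt : t * (t * u) = u := by rw [← mul_assoc, ht.mul_self, one_mul]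
    obtain ⟨j, hj, hje⟩ := ht.exists_eraseIdx_eq_mul_left (ω := a :: ω)
      (by rw [← he', htt]; exact hl)
    rw [← he', htt] at hje
    cases j with
    | zero =>
      rw [List.eraseIdx_cons_zero, ← he] at hje
      have : cs.simple a * u = t * u := by nth_rewrite 1 [← hje]; simp
      rw [this]
    | succ j =>
      exfalso
      rw [List.eraseIdx_cons_succ, wordProd_cons] at hje
      have h7 : cs.simple a * u = cs.wordProd (ω.eraseIdx j) := by rw [← hje]; simp
      have := cs.length_wordProd_le (ω.eraseIdx j)
      have h8 := List.length_eraseIdx_add_one (l := ω) (i := j) (by simpa using hj)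
      rw [← h7] at this
      have := hω.eq
      rw [← he] at this
      omega

theorem bruhatLE_demazureProd_of_sublist {ω' ω : List B} (h : ω'.Sublist ω) :
    cs.BruhatLE (cs.demazureProd ω') (cs.demazureProd ω) := by
  induction h with
  | slnil => exact Relation.ReflTransGen.refl
  | cons a h ih => exact ih.trans (cs.bruhatLE_simpleDemazure a _)
  | cons_cons a h ih => exact ih.simpleDemazure a

/-! ### Words containing a reduced expression -/

/-- Some subword of `ω` is a reduced expression of `x`. -/
def WordContains (ω : List B) (x : W) : Prop :=
  ∃ ω' : List B, ω'.Sublist ω ∧ IsReducedExpression cs ω' x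

variable {cs}

theorem WordContains.mono {ω ω' : List B} {x : W} (h : cs.WordContains ω x)
    (hs : ω.Sublist ω') : cs.WordContains ω' x :=
  let ⟨l, hl, hr⟩ := h; ⟨l, hl.trans hs, hr⟩

theorem WordContains.bruhatLE {ω : List B} {x : W} (h : cs.WordContains ω x) :
    cs.BruhatLE x (cs.demazureProd ω) := by
  obtain ⟨l, hl, hr, rfl⟩ := h
  rw [← cs.demazureProd_eq_of_isReduced hr]
  exact cs.bruhatLE_demazureProd_of_sublist hl

theorem isReduced_cons_iff {a : B} {ω : List B} :
    cs.IsReduced (a :: ω) ↔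
      cs.IsReduced ω ∧ cs.length (cs.wordProd ω) < cs.length (cs.simple a * cs.wordProd ω) := by
  have h1 := cs.length_simple_mul (cs.wordProd ω) a
  have h2 := cs.length_wordProd_le ω
  constructor
  · intro h
    have hω : cs.IsReduced ω := by simpa using h.drop 1
    refine ⟨hω, ?_⟩
    rw [← wordProd_cons, h.eq, hω.eq]
    simp
  · rintro ⟨h, h3⟩
    rw [IsReduced, wordProd_cons, List.length_cons, ← h.eq]
    omega

@[simp] theorem wordContains_nil {x : W} : cs.WordContains [] x ↔ x = 1 := by
  constructor
  · rintro ⟨l, hl, hr, rfl⟩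
    rw [List.sublist_nil.1 hl]; simp
  · rintro rfl
    exact ⟨[], List.Sublist.refl _, by simp [IsReduced], by simp⟩

theorem wordContains_cons_iff {a : B} {ω : List B} {x : W} :
    cs.WordContains (a :: ω) x ↔ cs.WordContains ω x ∨
      (cs.length (cs.simple a * x) < cs.length x ∧ cs.WordContains ω (cs.simple a * x)) := by
  constructor
  · rintro ⟨l, hl, hr, rfl⟩
    rcases List.sublist_cons_iff.1 hl with h | ⟨l', rfl, h⟩
    · exact Or.inl ⟨l, h, hr, rfl⟩
    · obtain ⟨h1, h2⟩ := isReduced_cons_iff.1 hr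
      refine Or.inr ⟨by simpa [wordProd_cons] using h2, l', h, h1, by simp [wordProd_cons]⟩
  · rintro (h | ⟨h, l, hl, hr, he⟩)
    · exact h.mono (List.sublist_cons_self a ω)
    · refine ⟨a :: l, hl.cons_cons a, isReduced_cons_iff.2 ⟨hr, ?_⟩, ?_⟩
      · simpa [he] using h
      · simp [wordProd_cons, he]

/-- By the exchange property, a letter can be erased from a reduced expression of `x` to obtain one
of `s * x`. -/
theorem WordContains.simple_mul {a : B} {ω : List B} {x : W} (h : cs.WordContains ω x)
    (hx : cs.length (cs.simple a * x) < cs.length x) : cs.WordContains ω (cs.simple a * x) := by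
  obtain ⟨l, hl, hr, rfl⟩ := h
  obtain ⟨j, hj, he⟩ := (cs.isReflection_simple a).exists_eraseIdx_eq_mul_left hx
  refine ⟨l.eraseIdx j, (List.eraseIdx_sublist l j).trans hl, ?_, he⟩
  have h1 := List.length_eraseIdx_add_one hj
  have h2 := cs.length_simple_mul (cs.wordProd l) a
  have := hr.eq
  rw [IsReduced, he]
  omega

theorem wordContains_cons_of_lt {a : B} {ω : List B} {x : W}
    (hx : cs.length (cs.simple a * x) < cs.length x) :
    cs.WordContains (a :: ω) x ↔ cs.WordContains ω (cs.simple a * x) := by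
  rw [wordContains_cons_iff]
  exact ⟨fun h => h.elim (fun h => h.simple_mul hx) (·.2), fun h => Or.inr ⟨hx, h⟩⟩

theorem wordContains_cons_of_not_lt {a : B} {ω : List B} {x : W}
    (hx : ¬ cs.length (cs.simple a * x) < cs.length x) :
    cs.WordContains (a :: ω) x ↔ cs.WordContains ω x := by
  simp [wordContains_cons_iff, hx]

theorem wordContains_reverse_inv {ω : List B} {x : W} :
    cs.WordContains ω.reverse x⁻¹ ↔ cs.WordContains ω x := by
  have key : ∀ (ω : List B) (x : W), cs.WordContains ω x → cs.WordContains ω.reverse x⁻¹ := by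
    rintro ω x ⟨l, hl, hr, rfl⟩
    exact ⟨l.reverse, hl.reverse, hr.reverse, by simp⟩
  exact ⟨fun h => by simpa using key _ _ h, key _ _⟩

theorem wordContains_concat_of_lt {b : B} {ω : List B} {x : W}
    (hx : cs.length (x * cs.simple b) < cs.length x) :
    cs.WordContains (ω ++ [b]) x ↔ cs.WordContains ω (x * cs.simple b) := by
  rw [← wordContains_reverse_inv, List.reverse_append, List.reverse_singleton,
    List.singleton_append, wordContains_cons_of_lt, ← wordContains_reverse_inv (ω := ω)]
  · simp
  · rw [← cs.length_inv] at hx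
    simpa using hx

theorem wordContains_demazureProd (ω : List B) : cs.WordContains ω (cs.demazureProd ω) := by
  induction ω with
  | nil => simp
  | cons a ω ih =>
    rw [demazureProd_cons, simpleDemazure, wordContains_cons_iff]
    split_ifs with h
    · exact Or.inl ih
    · refine Or.inr ⟨?_, by simpa using ih⟩
      have := cs.length_simple_mul_ne (cs.demazureProd ω) a
      rw [simple_mul_simple_cancel_left]
      omega

/-- Once `x` is the Demazure product of a word, the subwords containing `x` are those with
Demazure product `x`. -/
theorem wordContains_iff_demazureProd_eq {ω' ω : List B} (hs : ω'.Sublist ω) :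
    cs.WordContains ω' (cs.demazureProd ω) ↔ cs.demazureProd ω' = cs.demazureProd ω :=
  ⟨fun h => (cs.bruhatLE_demazureProd_of_sublist hs).antisymm h.bruhatLE,
    fun h => h ▸ wordContains_demazureProd ω'⟩

/-- A reduced word `ρ` at the end can be cancelled when `x` ends with it. -/
theorem wordContains_append_iff {ω ρ : List B} {u : W} (hρ : cs.IsReduced ρ)
    (hu : cs.length (u * cs.wordProd ρ) = cs.length u + ρ.length) :
    cs.WordContains (ω ++ ρ) (u * cs.wordProd ρ) ↔ cs.WordContains ω u := by
  induction ρ using List.reverseRecOn with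
  | nil => simp
  | append_singleton ρ b ih =>
    have h1 : cs.wordProd (ρ ++ [b]) * cs.simple b = cs.wordProd ρ := by
      simp [wordProd_append, mul_assoc]
    have hρ' : cs.IsReduced ρ := by simpa using hρ.take ρ.length
    have h2 := cs.length_mul_simple (u * cs.wordProd (ρ ++ [b])) b
    have h3 := cs.length_mul_le u (cs.wordProd ρ)
    rw [mul_assoc, h1] at h2
    rw [hρ'.eq] at h3
    rw [List.length_append, List.length_singleton] at hu
    rw [← List.append_assoc, wordContains_concat_of_lt (by rw [mul_assoc, h1]; omega),
      mul_assoc, h1, ih hρ' (by omega)]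

/-- The Demazure product of a word has the Demazure product of any suffix of the word as a suffix,
with lengths adding up. -/
theorem length_demazureProd_append (ω ρ : List B) :
    cs.length (cs.demazureProd (ω ++ ρ) * (cs.demazureProd ρ)⁻¹) + cs.length (cs.demazureProd ρ) =
      cs.length (cs.demazureProd (ω ++ ρ)) := by
  induction ω with
  | nil => simp
  | cons a ω ih =>
    rw [List.cons_append, demazureProd_cons, simpleDemazure]
    split_ifs with h
    · exact ih
    · have h1 := cs.length_simple_mul (cs.demazureProd (ω ++ ρ)) a
      have h2 := cs.length_simple_mul (cs.demazureProd (ω ++ ρ) * (cs.demazureProd ρ)⁻¹) a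
      have h3 := cs.length_mul_le
        (cs.simple a * (cs.demazureProd (ω ++ ρ) * (cs.demazureProd ρ)⁻¹)) (cs.demazureProd ρ)
      rw [mul_assoc, mul_assoc, inv_mul_cancel, mul_one] at h3
      rw [mul_assoc]
      omega

end CoxeterSystem

/-! ### Vertex decomposable complexes with facets of a given size -/

namespace SimplicialCx

variable {V : Type*} [DecidableEq V]

/-- `Δ` is vertex decomposable and all its facets have `c` elements. The number `c` is an integer,
so that a complex without faces has the property for every `c`. -/
def PureVertexDecomposable (Δ : SimplicialCx V) (c : ℤ) : Prop :=
  Δ.VertexDecomposable ∧ ∀ F ∈ Δ.facets, (F.card : ℤ) = c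

omit [DecidableEq V] in
theorem mem_deletion_singleton {Δ : SimplicialCx V} {v : V} {J : Finset V} :
    J ∈ Δ.deletion {v} ↔ J ∈ Δ ∧ v ∉ J := by
  change J ∈ Δ ∧ ¬ {v} ⊆ J ↔ _
  rw [Finset.singleton_subset_iff]

theorem mem_link_singleton {Δ : SimplicialCx V} {v : V} {J : Finset V} :
    J ∈ Δ.link {v} ↔ insert v J ∈ Δ ∧ v ∉ J := by
  change {v} ∪ J ∈ Δ ∧ {v} ∩ J = ∅ ↔ _
  rw [← Finset.insert_eq, ← Finset.disjoint_iff_inter_eq_empty, Finset.disjoint_singleton_left]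

theorem singleton_mem_of_link_nonempty {Δ : SimplicialCx V} {v : V} {J : Finset V}
    (h : J ∈ Δ.link {v}) : {v} ∈ Δ :=
  Δ.lower (by simp) (mem_link_singleton.1 h).1

omit [DecidableEq V] in
theorem mem_facets_deletion {Δ : SimplicialCx V} {v : V} {F : Finset V} (hF : F ∈ Δ.facets)
    (hv : v ∉ F) : F ∈ (Δ.deletion {v}).facets :=
  ⟨mem_deletion_singleton.2 ⟨hF.1, hv⟩, fun _ hG h => hF.2 (mem_deletion_singleton.1 hG).1 h⟩

theorem erase_mem_facets_link {Δ : SimplicialCx V} {v : V} {F : Finset V} (hF : F ∈ Δ.facets)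
    (hv : v ∈ F) : F.erase v ∈ (Δ.link {v}).facets := by
  refine ⟨mem_link_singleton.2 ⟨by rw [Finset.insert_erase hv]; exact hF.1, by simp⟩, ?_⟩
  intro G hG h
  obtain ⟨h1, h2⟩ := mem_link_singleton.1 hG
  have h3 : F ≤ insert v G := by
    rw [← Finset.insert_erase hv]; exact Finset.insert_subset_insert v h
  exact Finset.subset_erase.2 ⟨(Finset.subset_insert v G).trans (hF.2 h1 h3), h2⟩

namespace PureVertexDecomposable

theorem of_forall_notMem {Δ : SimplicialCx V} (h : ∀ J, J ∉ Δ) (c : ℤ) :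
    Δ.PureVertexDecomposable c :=
  ⟨.simplex _ (Or.inl h), fun F hF => (h F hF.1).elim⟩

theorem of_mem_iff_eq_empty {Δ : SimplicialCx V} (h : ∀ J, J ∈ Δ ↔ J = ∅) :
    Δ.PureVertexDecomposable 0 :=
  ⟨.simplex _ (Or.inr ⟨∅, by simpa using h⟩), fun F hF => by simp [(h F).1 hF.1]⟩

theorem of_vertex {Δ : SimplicialCx V} {v : V} {c n : ℤ} (hv : {v} ∈ Δ)
    (hdel : (Δ.deletion {v}).PureVertexDecomposable c)
    (hlink : (Δ.link {v}).PureVertexDecomposable n) (hn : n + 1 = c) :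
    Δ.PureVertexDecomposable c := by
  have hc : ∀ F ∈ Δ.facets, (F.card : ℤ) = c := by
    intro F hF
    by_cases h : v ∈ F
    · rw [← hn, ← hlink.2 _ (erase_mem_facets_link hF h), ← Finset.card_erase_add_one h]
      simp
    · exact hdel.2 F (mem_facets_deletion hF h)
  refine ⟨.vertex Δ (fun F hF G hG => ?_) v hv hdel.1 hlink.1, hc⟩
  exact_mod_cast (hc F hF).trans (hc G hG).symm

theorem of_cone {Δ : SimplicialCx V} {v : V} {c n : ℤ} (hv : ∀ J ∈ Δ, insert v J ∈ Δ)
    (hlink : (Δ.link {v}).PureVertexDecomposable n) (hn : n + 1 = c) :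
    Δ.PureVertexDecomposable c := by
  by_cases hne : ∃ J, J ∈ Δ
  swap
  · exact of_forall_notMem (by simpa using hne) c
  obtain ⟨J, hJ⟩ := hne
  have hdel : Δ.deletion {v} = Δ.link {v} := by
    ext J
    rw [SetLike.mem_coe, SetLike.mem_coe, mem_deletion_singleton, mem_link_singleton]
    exact and_congr_left fun _ => ⟨hv J, fun h => Δ.lower (Finset.subset_insert v J) h⟩
  have hc : ∀ F ∈ Δ.facets, (F.card : ℤ) = c := by
    intro F hF
    have h : v ∈ F := hF.2 (hv F hF.1) (Finset.subset_insert v F) (Finset.mem_insert_self v F)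
    rw [← hn, ← hlink.2 _ (erase_mem_facets_link hF h), ← Finset.card_erase_add_one h]
    simp
  refine ⟨.vertex Δ (fun F hF G hG => ?_) v (Δ.lower (by simp) (hv J hJ)) (hdel ▸ hlink.1)
    hlink.1, hc⟩
  exact_mod_cast (hc F hF).trans (hc G hG).symm

theorem of_deletion {Δ : SimplicialCx V} {v : V} {c : ℤ} (hv : {v} ∉ Δ)
    (hdel : (Δ.deletion {v}).PureVertexDecomposable c) : Δ.PureVertexDecomposable c := by
  have : Δ.deletion {v} = Δ := by
    ext J
    rw [SetLike.mem_coe, SetLike.mem_coe, mem_deletion_singleton]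
    exact and_iff_left_of_imp fun h hvJ => hv (Δ.lower (by simpa using hvJ) h)
  rwa [this] at hdel

end PureVertexDecomposable

end SimplicialCx

/-! ### Subword complexes with a frozen factor -/

section RestWord

variable {V B : Type*} [DecidableEq V] (Q : V → B)

/-- The word that the labelling `Q` of positions spells along the list `L` of positions when the
positions in `J` are left out. -/
def restWord (L : List V) (J : Finset V) : List B :=
  (L.filter (· ∉ J)).map Q

@[simp] theorem restWord_nil (J : Finset V) : restWord Q [] J = [] := rfl

theorem restWord_cons_of_mem {v : V} (L : List V) {J : Finset V} (h : v ∈ J) :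
    restWord Q (v :: L) J = restWord Q L J := by
  simp [restWord, h]

theorem restWord_cons_of_notMem {v : V} (L : List V) {J : Finset V} (h : v ∉ J) :
    restWord Q (v :: L) J = Q v :: restWord Q L J := by
  simp [restWord, h]

@[simp] theorem restWord_append (L L' : List V) (J : Finset V) :
    restWord Q (L ++ L') J = restWord Q L J ++ restWord Q L' J := by
  simp [restWord]

theorem restWord_insert {v : V} {L : List V} (h : v ∉ L) (J : Finset V) :
    restWord Q L (insert v J) = restWord Q L J := by
  unfold restWord
  congr 1
  apply List.filter_congr
  intro u hu
  have : u ≠ v := fun e => h (e ▸ hu)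
  simp [this]

@[simp] theorem restWord_empty (L : List V) : restWord Q L ∅ = L.map Q := by
  simp [restWord]

theorem restWord_sublist_restWord (L : List V) {J J' : Finset V} (h : J ⊆ J') :
    (restWord Q L J').Sublist (restWord Q L J) := by
  refine List.Sublist.map _ (List.monotone_filter_right L fun u hu => ?_)
  simp only [decide_eq_true_eq] at hu ⊢
  exact fun h' => hu (h h')

theorem restWord_sublist (L : List V) (J : Finset V) : (restWord Q L J).Sublist (L.map Q) :=
  List.filter_sublist.map _

end RestWord

section FactorComplex

open CoxeterSystem

variable {V B W : Type*} [DecidableEq V] [Group W] {M : CoxeterMatrix B}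
  (cs : CoxeterSystem M W) (Q : V → B)

/-- The complex of the sets `J` of positions of `A` and `C` such that the word spelled by
`A ∖ J`, the word `ρ` and the word spelled by `C ∖ J`, in this order, contain a reduced expression
of `x`. The letters of the middle factor `ρ` are not vertices. -/
def factorComplex (A : List V) (ρ : List B) (C : List V) (x : W) : SimplicialCx V where
  carrier := {J | (∀ v ∈ J, v ∈ A ∨ v ∈ C) ∧
    cs.WordContains (restWord Q A J ++ ρ ++ restWord Q C J) x}
  lower' := fun _ _ hba ha => ⟨fun v hv => ha.1 v (hba hv), ha.2.mono
    (((restWord_sublist_restWord Q A hba).append_right ρ).append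
      (restWord_sublist_restWord Q C hba))⟩

/-- The subword complex of the word that `Q` spells along the list `L` of positions. -/
def listComplex (L : List V) (x : W) : SimplicialCx V := factorComplex cs Q L [] [] x

variable {cs Q}

theorem mem_factorComplex {A C : List V} {ρ : List B} {x : W} {J : Finset V} :
    J ∈ factorComplex cs Q A ρ C x ↔ (∀ v ∈ J, v ∈ A ∨ v ∈ C) ∧
      cs.WordContains (restWord Q A J ++ ρ ++ restWord Q C J) x := Iff.rfl

theorem mem_listComplex {L : List V} {x : W} {J : Finset V} :
    J ∈ listComplex cs Q L x ↔ (∀ v ∈ J, v ∈ L) ∧ cs.WordContains (restWord Q L J) x := by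
  simp [listComplex, mem_factorComplex]

theorem deletion_factorComplex {A C : List V} {ρ : List B} {x : W} {v : V} (hA : v ∉ A)
    (hC : v ∉ C) : (factorComplex cs Q A ρ (v :: C) x).deletion {v} =
      factorComplex cs Q A (ρ ++ [Q v]) C x := by
  ext J
  rw [SetLike.mem_coe, SetLike.mem_coe, SimplicialCx.mem_deletion_singleton, mem_factorComplex,
    mem_factorComplex]
  constructor
  · rintro ⟨⟨h1, h2⟩, h3⟩
    refine ⟨fun u hu => ?_, by simpa [restWord_cons_of_notMem _ _ h3] using h2⟩
    have := h1 u hu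
    have huv : u ≠ v := fun e => h3 (e ▸ hu)
    simpa [huv] using this
  · rintro ⟨h1, h2⟩
    have h3 : v ∉ J := fun h => (h1 v h).elim hA hC
    exact ⟨⟨fun u hu => (h1 u hu).imp_right (List.mem_cons_of_mem v),
      by simpa [restWord_cons_of_notMem _ _ h3] using h2⟩, h3⟩

theorem link_factorComplex {A C : List V} {ρ : List B} {x : W} {v : V} (hA : v ∉ A)
    (hC : v ∉ C) : (factorComplex cs Q A ρ (v :: C) x).link {v} = factorComplex cs Q A ρ C x := by
  ext J
  rw [SetLike.mem_coe, SetLike.mem_coe, SimplicialCx.mem_link_singleton, mem_factorComplex,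
    mem_factorComplex, restWord_cons_of_mem _ _ (Finset.mem_insert_self v J), restWord_insert Q hA,
    restWord_insert Q hC]
  constructor
  · rintro ⟨⟨h1, h2⟩, h3⟩
    refine ⟨fun u hu => ?_, h2⟩
    have := h1 u (Finset.mem_insert_of_mem hu)
    have huv : u ≠ v := fun e => h3 (e ▸ hu)
    simpa [huv] using this
  · rintro ⟨h1, h2⟩
    refine ⟨⟨fun u hu => ?_, h2⟩, fun h => (h1 v h).elim hA hC⟩
    rcases Finset.mem_insert.1 hu with rfl | hu
    · simp
    · exact (h1 u hu).imp_right (List.mem_cons_of_mem v)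

theorem listComplex_append (A C : List V) (x : W) :
    listComplex cs Q (A ++ C) x = factorComplex cs Q A [] C x := by
  ext J
  rw [SetLike.mem_coe, SetLike.mem_coe, mem_listComplex, mem_factorComplex]
  simp

theorem deletion_listComplex_append {A C : List V} {x : W} {v : V} (hA : v ∉ A) (hC : v ∉ C) :
    (listComplex cs Q (A ++ v :: C) x).deletion {v} = factorComplex cs Q A [Q v] C x := by
  rw [listComplex_append, deletion_factorComplex hA hC]; rfl

theorem link_listComplex_append {A C : List V} {x : W} {v : V} (hA : v ∉ A) (hC : v ∉ C) :
    (listComplex cs Q (A ++ v :: C) x).link {v} = listComplex cs Q (A ++ C) x := by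
  rw [listComplex_append, link_factorComplex hA hC, listComplex_append]

theorem deletion_listComplex_cons_of_lt {L : List V} {x : W} {v : V} (hL : v ∉ L)
    (hx : cs.length (cs.simple (Q v) * x) < cs.length x) :
    (listComplex cs Q (v :: L) x).deletion {v} = listComplex cs Q L (cs.simple (Q v) * x) := by
  rw [← List.nil_append (v :: L), deletion_listComplex_append (by simp) hL]
  ext J
  rw [SetLike.mem_coe, SetLike.mem_coe, mem_listComplex, mem_factorComplex]
  simp [wordContains_cons_of_lt hx]

theorem link_listComplex_cons {L : List V} {x : W} {v : V} (hL : v ∉ L) :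
    (listComplex cs Q (v :: L) x).link {v} = listComplex cs Q L x :=
  link_listComplex_append (A := []) (by simp) hL

theorem insert_mem_listComplex_cons {L : List V} {x : W} {v : V} (hL : v ∉ L)
    (hx : ¬ cs.length (cs.simple (Q v) * x) < cs.length x) {J : Finset V}
    (hJ : J ∈ listComplex cs Q (v :: L) x) : insert v J ∈ listComplex cs Q (v :: L) x := by
  rw [mem_listComplex] at hJ ⊢
  refine ⟨by simpa using hJ.1, ?_⟩
  rw [restWord_cons_of_mem _ _ (Finset.mem_insert_self v J), restWord_insert Q hL]
  by_cases h : v ∈ J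
  · simpa [restWord_cons_of_mem _ _ h] using hJ.2
  · simpa [restWord_cons_of_notMem _ _ h, wordContains_cons_of_not_lt hx] using hJ.2

/-- Subword complexes are vertex decomposable: the deletion and the link of the first letter are
again subword complexes. -/
theorem pureVertexDecomposable_listComplex {L : List V} (hL : L.Nodup) (x : W) :
    (listComplex cs Q L x).PureVertexDecomposable (L.length - cs.length x) := by
  induction L generalizing x with
  | nil =>
    by_cases hx : x = 1
    · subst hx
      simpa using SimplicialCx.PureVertexDecomposable.of_mem_iff_eq_empty
        (Δ := listComplex cs Q [] 1) fun J => by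
          simp [mem_listComplex, Finset.eq_empty_iff_forall_notMem]
    · exact .of_forall_notMem (fun J => by simp [mem_listComplex, hx]) _
  | cons v L ih =>
    obtain ⟨hv, hL⟩ := List.nodup_cons.1 hL
    have hlink := ih hL x
    rw [← link_listComplex_cons hv] at hlink
    by_cases hx : cs.length (cs.simple (Q v) * x) < cs.length x
    · have hdel := ih hL (cs.simple (Q v) * x)
      rw [← deletion_listComplex_cons_of_lt hv hx,
        show (L.length : ℤ) - cs.length (cs.simple (Q v) * x) =
          (v :: L).length - cs.length x by
            have := cs.length_simple_mul x (Q v)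
            rw [List.length_cons]; omega] at hdel
      by_cases h : {v} ∈ listComplex cs Q (v :: L) x
      · exact .of_vertex h hdel hlink (by rw [List.length_cons]; push_cast; ring)
      · exact .of_deletion h hdel
    · exact .of_cone (fun J => insert_mem_listComplex_cons hv hx) hlink
        (by rw [List.length_cons]; push_cast; ring)

theorem restWord_factor_sublist (A C : List V) (ρ : List B) (J : Finset V) :
    (restWord Q A J ++ ρ ++ restWord Q C J).Sublist (A.map Q ++ ρ ++ C.map Q) :=
  ((restWord_sublist Q A J).append_right ρ).append (restWord_sublist Q C J)

/-- If the Demazure product of the whole word is `x`, then a frozen factor matters only through its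
Demazure product. -/
theorem factorComplex_congr {A C : List V} {ρ ρ' : List B} {x : W}
    (hx : cs.demazureProd (A.map Q ++ ρ ++ C.map Q) = x)
    (hρ : cs.demazureProd ρ = cs.demazureProd ρ') :
    factorComplex cs Q A ρ C x = factorComplex cs Q A ρ' C x := by
  have hx' := hx
  rw [cs.demazureProd_congr hρ] at hx'
  ext J
  rw [SetLike.mem_coe, SetLike.mem_coe, mem_factorComplex, mem_factorComplex]
  refine and_congr_right fun _ => ?_
  have h1 := wordContains_iff_demazureProd_eq (cs := cs) (restWord_factor_sublist (Q := Q) A C ρ J)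
  have h2 := wordContains_iff_demazureProd_eq (cs := cs) (restWord_factor_sublist (Q := Q) A C ρ' J)
  rw [hx] at h1
  rw [hx'] at h2
  rw [h1, h2, cs.demazureProd_congr hρ]

/-- A subword complex with a frozen factor at the end of the word is a subword complex. -/
theorem factorComplex_nil_eq {A : List V} {ρ : List B} {x : W}
    (hx : cs.demazureProd (A.map Q ++ ρ) = x) :
    factorComplex cs Q A ρ [] x = listComplex cs Q A (x * (cs.demazureProd ρ)⁻¹) := by
  obtain ⟨ω, hω, he⟩ := cs.exists_isReduced (cs.demazureProd ρ)
  have hd : cs.demazureProd ρ = cs.demazureProd ω := by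
    rw [he, demazureProd_eq_of_isReduced cs hω]
  rw [factorComplex_congr (by simpa using hx) hd, ← hx]
  have hl := length_demazureProd_append (cs := cs) (A.map Q) ρ
  ext J
  rw [SetLike.mem_coe, SetLike.mem_coe, mem_factorComplex, mem_listComplex]
  simp only [restWord_nil, List.append_nil, List.not_mem_nil, or_false]
  refine and_congr_right fun _ => ?_
  have key := wordContains_append_iff (ω := restWord Q A J)
    (u := cs.demazureProd (A.map Q ++ ρ) * (cs.demazureProd ρ)⁻¹) hω
    (by rw [← he, inv_mul_cancel_right, ← hl, he, hω.eq])
  rwa [← he, inv_mul_cancel_right] at key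

/-- A subword complex with a frozen factor is vertex decomposable if the Demazure product of the
whole word is `x`. The letters to the right of the frozen factor are removed one by one from the
left: deleting such a letter adds it to the frozen factor. -/
theorem pureVertexDecomposable_factorComplex {A C : List V} (hAC : (A ++ C).Nodup) (ρ : List B)
    {x : W} (hx : cs.demazureProd (A.map Q ++ ρ ++ C.map Q) = x) :
    (factorComplex cs Q A ρ C x).PureVertexDecomposable
      (A.length + C.length + cs.length (cs.demazureProd ρ) - cs.length x) := by
  induction C generalizing ρ with
  | nil =>
    rw [List.map_nil, List.append_nil] at hx
    rw [factorComplex_nil_eq hx]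
    convert pureVertexDecomposable_listComplex (cs := cs) (Q := Q) (by simpa using hAC) _ using 1
    have hl := length_demazureProd_append (cs := cs) (A.map Q) ρ
    rw [hx] at hl
    rw [← hl]
    simp
  | cons v C ih =>
    have hvAC := (List.nodup_middle.1 hAC)
    obtain ⟨hv, hAC'⟩ := List.nodup_cons.1 hvAC
    have hA : v ∉ A := fun h => hv (List.mem_append_left _ h)
    have hC : v ∉ C := fun h => hv (List.mem_append_right _ h)
    have hxdel : cs.demazureProd (A.map Q ++ (ρ ++ [Q v]) ++ C.map Q) = x := by
      rw [← hx]; simp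
    have hdel := ih hAC' (ρ ++ [Q v]) hxdel
    have hlink : ((factorComplex cs Q A ρ (v :: C) x).link {v}).PureVertexDecomposable
        (A.length + C.length + cs.length (cs.demazureProd ρ) - cs.length x) := by
      rw [link_factorComplex hA hC]
      -- If the link has a face, then the Demazure product of the whole word is still `x` without
      -- the letter at `v`.
      by_cases h : ∃ J, J ∈ factorComplex cs Q A ρ C x
      · obtain ⟨J, hJ⟩ := h
        have hs : (A.map Q ++ ρ ++ C.map Q).Sublist (A.map Q ++ ρ ++ (v :: C).map Q) := by
          simp
        refine ih hAC' ρ ?_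
        rw [← hx, ← wordContains_iff_demazureProd_eq hs, hx]
        exact (mem_factorComplex.1 hJ).2.mono (restWord_factor_sublist A C ρ J)
      · exact .of_forall_notMem (by simpa using h) _
    have hlen : ((v :: C).length : ℤ) = C.length + 1 := by simp
    have hs := cs.length_mul_simple (cs.demazureProd ρ) (Q v)
    by_cases hup : cs.length (cs.demazureProd ρ * cs.simple (Q v)) < cs.length (cs.demazureProd ρ)
    · -- The frozen factor `ρ` absorbs the letter, so that `v` is the apex of a cone.
      have hρ : cs.demazureProd (ρ ++ [Q v]) = cs.demazureProd ρ := by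
        rw [demazureProd_concat, demazureSimple, if_pos hup]
      refine .of_cone (fun J hJ => ?_) hlink (by rw [hlen]; ring)
      by_cases h : v ∈ J
      · rwa [Finset.insert_eq_of_mem h]
      · have h1 := SimplicialCx.mem_deletion_singleton.2 ⟨hJ, h⟩
        rw [deletion_factorComplex hA hC, factorComplex_congr hxdel hρ,
          ← link_factorComplex hA hC] at h1
        exact (SimplicialCx.mem_link_singleton.1 h1).1
    · have hρ : cs.length (cs.demazureProd (ρ ++ [Q v])) = cs.length (cs.demazureProd ρ) + 1 := by
        rw [demazureProd_concat, demazureSimple, if_neg hup]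
        omega
      rw [← deletion_factorComplex hA hC, hρ] at hdel
      push_cast at hdel
      rw [show (A.length : ℤ) + C.length + (cs.length (cs.demazureProd ρ) + 1) - cs.length x =
        A.length + (v :: C).length + cs.length (cs.demazureProd ρ) - cs.length x by
          rw [hlen]; ring] at hdel
      by_cases h : {v} ∈ factorComplex cs Q A ρ (v :: C) x
      · exact .of_vertex h hdel hlink (by rw [hlen]; ring)
      · exact .of_deletion h hdel

/-- Induction on the size of `I`: the deletion of a vertex `v ∈ I` from `Δ.deletion I` is a
subword complex with the frozen factor `v`, and the link of `v` is the deletion of `I ∖ {v}` from a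
smaller subword complex. -/
theorem pureVertexDecomposable_deletion_listComplex {L : List V} (hL : L.Nodup) {x : W}
    (hx : cs.demazureProd (L.map Q) = x) {I : Finset V} (hI : I ∈ listComplex cs Q L x)
    (hne : I.Nonempty) :
    ((listComplex cs Q L x).deletion I).PureVertexDecomposable (L.length - cs.length x) := by
  have hsplit : ∀ v ∈ L, ∃ A C, L = A ++ v :: C := fun v hv => List.append_of_mem hv
  induction hne using Finset.Nonempty.cons_induction generalizing L with
  | singleton v =>
    obtain ⟨A, C, rfl⟩ := hsplit v ((mem_listComplex.1 hI).1 v (by simp))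
    obtain ⟨hv, hAC⟩ := List.nodup_cons.1 (List.nodup_middle.1 hL)
    rw [deletion_listComplex_append (fun h => hv (List.mem_append_left _ h))
      (fun h => hv (List.mem_append_right _ h))]
    convert pureVertexDecomposable_factorComplex (cs := cs) (Q := Q) (x := x) hAC [Q v]
      (by rw [← hx]; simp) using 1
    rw [demazureProd_eq_of_isReduced cs (by simp [CoxeterSystem.IsReduced])]
    simp
    ring
  | cons v I hvI hI' ih =>
    obtain ⟨A, C, rfl⟩ := hsplit v ((mem_listComplex.1 hI).1 v (by simp))
    obtain ⟨hv, hAC⟩ := List.nodup_cons.1 (List.nodup_middle.1 hL)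
    have hA : v ∉ A := fun h => hv (List.mem_append_left _ h)
    have hC : v ∉ C := fun h => hv (List.mem_append_right _ h)
    rw [Finset.cons_eq_insert] at hI ⊢
    have hIlink : I ∈ listComplex cs Q (A ++ C) x := by
      rw [← link_listComplex_append hA hC, SimplicialCx.mem_link_singleton]
      exact ⟨hI, hvI⟩
    have hs : ((A ++ C).map Q).Sublist ((A ++ v :: C).map Q) := by
      simp
    have hx' : cs.demazureProd ((A ++ C).map Q) = x := by
      rw [← hx, ← wordContains_iff_demazureProd_eq hs, hx]
      exact (mem_listComplex.1 hIlink).2.mono (restWord_sublist Q _ I)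
    have hdel := pureVertexDecomposable_factorComplex (cs := cs) (Q := Q) (x := x) hAC [Q v]
      (by rw [← hx]; simp)
    rw [← deletion_listComplex_append hA hC,
      demazureProd_eq_of_isReduced cs (by simp [CoxeterSystem.IsReduced])] at hdel
    have hlink := ih hAC hx' hIlink fun v hv => List.append_of_mem hv
    rw [← link_listComplex_append hA hC] at hlink
    have edel : ((listComplex cs Q (A ++ v :: C) x).deletion (insert v I)).deletion {v} =
        (listComplex cs Q (A ++ v :: C) x).deletion {v} := by
      ext J
      rw [SetLike.mem_coe, SetLike.mem_coe, SimplicialCx.mem_deletion_singleton,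
        SimplicialCx.mem_deletion_singleton]
      exact and_congr_left fun h =>
        ⟨fun h' => h'.1, fun h' => ⟨h', fun h'' => h (h'' (Finset.mem_insert_self v I))⟩⟩
    have elink : ((listComplex cs Q (A ++ v :: C) x).deletion (insert v I)).link {v} =
        ((listComplex cs Q (A ++ v :: C) x).link {v}).deletion I := by
      ext J
      rw [SetLike.mem_coe, SimplicialCx.mem_link_singleton]
      change (insert v J ∈ listComplex cs Q (A ++ v :: C) x ∧ ¬ insert v I ⊆ insert v J) ∧ v ∉ J ↔
        J ∈ (listComplex cs Q (A ++ v :: C) x).link {v} ∧ ¬ I ⊆ J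
      rw [SimplicialCx.mem_link_singleton, Finset.insert_subset_insert_iff hvI]
      tauto
    rw [← edel] at hdel
    rw [← elink] at hlink
    refine .of_vertex (v := v) ⟨SimplicialCx.singleton_mem_of_link_nonempty
      (SimplicialCx.mem_link_singleton.2 ⟨hI, hvI⟩), fun h => ?_⟩ ?_ hlink ?_
    · obtain ⟨u, hu⟩ := hI'
      have := h (Finset.mem_insert_of_mem hu)
      rw [Finset.mem_singleton] at this
      exact hvI (this ▸ hu)
    · convert hdel using 1
      simp
      ring
    · simp
      ring

omit [DecidableEq V] in
/-- Since all facets have the same size, the costar of `I` is the deletion of `I`. -/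
theorem SimplicialCx.costar_eq_deletion [Finite V] {Δ : SimplicialCx V} {I : Finset V} {c : ℤ}
    (hΔ : ∀ F ∈ Δ.facets, (F.card : ℤ) = c) (hI : ∀ F ∈ (Δ.deletion I).facets, (F.card : ℤ) = c) :
    Δ.costar I = Δ.deletion I := by
  have hfin : ∀ (Γ : SimplicialCx V), ∀ J ∈ Γ, ∃ F ∈ Γ.facets, J ⊆ F := fun Γ J hJ =>
    let ⟨F, hJF, hF⟩ := (Set.toFinite {J | J ∈ Γ}).exists_le_maximal hJ
    ⟨F, hF, hJF⟩
  ext J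
  rw [SetLike.mem_coe, SetLike.mem_coe]
  constructor
  · rintro ⟨F, hF, hJF, hIF⟩
    exact ⟨Δ.lower hJF hF.1, fun h => hIF (h.trans hJF)⟩
  · intro hJ
    obtain ⟨F, hF, hJF⟩ := hfin _ J hJ
    obtain ⟨G, hG, hFG⟩ := hfin Δ F hF.1.1
    have hcard : F.card = G.card := by exact_mod_cast (hI F hF).trans (hΔ G hG).symm
    rw [← Finset.eq_of_subset_of_card_le hFG hcard.ge] at hG
    exact ⟨F, hG, hJF, hF.1.2⟩

theorem List.Sublist.filter_mem_eq {l L : List V} (h : l.Sublist L) (hL : L.Nodup) :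
    L.filter (· ∈ l) = l := by
  induction h with
  | slnil => rfl
  | @cons l L a h ih =>
    obtain ⟨ha, hL⟩ := List.nodup_cons.1 hL
    rw [List.filter_cons_of_neg (by simpa using fun h' => ha (h.subset h')), ih hL]
  | @cons_cons l L a h ih =>
    obtain ⟨ha, hL⟩ := List.nodup_cons.1 hL
    rw [List.filter_cons_of_pos (by simp)]
    congr 1
    refine (List.filter_congr fun u hu => ?_).trans (ih hL)
    have : u ≠ a := fun e => ha (e ▸ hu)
    simp [this]

theorem subwordComplex_eq_listComplex {r : ℕ} (Q : Fin r → B) (x : W) :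
    subwordComplex cs Q x = listComplex cs Q (List.finRange r) x := by
  ext J
  rw [SetLike.mem_coe, SetLike.mem_coe, mem_listComplex]
  change (∃ F : Finset (Fin r), J ⊆ F ∧ IsReducedExpression cs (subword Q Fᶜ) x) ↔ _
  constructor
  · rintro ⟨F, hJF, hF⟩
    refine ⟨fun v _ => List.mem_finRange v, _, ?_, hF⟩
    have : subword Q Fᶜ = restWord Q (List.finRange r) F := by simp [subword, restWord]
    rw [this]
    exact restWord_sublist_restWord Q _ hJF
  · rintro ⟨-, ω, hω, hr⟩
    obtain ⟨l, hl, rfl⟩ := List.sublist_map_iff.1 hω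
    refine ⟨l.toFinsetᶜ, fun v hv => ?_, ?_⟩
    · rw [Finset.mem_compl, List.mem_toFinset]
      intro hvl
      have := hl.subset hvl
      simp [hv] at this
    · convert hr
      rw [subword, compl_compl]
      congr 1
      have hl' : l.Sublist (List.finRange r) := hl.trans List.filter_sublist
      simpa using hl'.filter_mem_eq (List.nodup_finRange r)

end FactorComplex

/-! ### The sphere is not a retract of the ball -/

section NoRetraction

open MeasureTheory Metric Set

/-- The value at `1` of the polynomial function `s ↦ det (1 + s • A)` is a combination of its
values at given nodes, with coefficients that sum to `1` and do not depend on `A`. -/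
theorem exists_det_one_add_eq_sum (E : Type*) [NormedAddCommGroup E] [NormedSpace ℝ E]
    [FiniteDimensional ℝ E] (t : ℕ → ℝ) (ht : Function.Injective t) :
    ∃ (N : ℕ) (c : ℕ → ℝ), ∑ i ∈ Finset.range N, c i = 1 ∧ ∀ A : E →L[ℝ] E,
      (1 + A).det = ∑ i ∈ Finset.range N, c i * (1 + t i • A).det := by
  classical
  -- Lagrange interpolation at `finrank + 1` nodes reproduces polynomials of degree at most `finrank`.
  let b := Module.finBasis ℝ E
  let n := Module.finrank ℝ E
  let c : ℕ → ℝ := fun i => (Lagrange.basis (Finset.range (n + 1)) t i).eval 1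
  have hdet : ∀ (A : E →L[ℝ] E) (s : ℝ), (1 + s • A).det =
      ((Matrix.det ((Polynomial.X : Polynomial ℝ) •
        (LinearMap.toMatrix b b (A : E →ₗ[ℝ] E)).map Polynomial.C +
          (1 : Matrix (Fin n) (Fin n) ℝ).map Polynomial.C)).eval s) := by
    intro A s
    rw [← Polynomial.coe_evalRingHom, RingHom.map_det, ContinuousLinearMap.det,
      ← LinearMap.det_toMatrix b]
    congr 1
    ext i j
    by_cases hij : i = j <;>
    simp [LinearMap.toMatrix_one, hij, add_comm, mul_comm s]
  refine ⟨n + 1, c, ?_, fun A => ?_⟩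
  · have := congrArg (Polynomial.eval 1)
      (Lagrange.sum_basis (ht.injOn (s := ↑(Finset.range (n + 1)))) (by simp))
    simpa [Polynomial.eval_finsetSum] using this
  · have h1 := hdet A 1
    rw [one_smul] at h1
    rw [h1, Lagrange.eq_interpolate (ht.injOn (s := ↑(Finset.range (n + 1))))
      (f := Matrix.det _) (lt_of_le_of_lt (Polynomial.degree_le_of_natDegree_le
        (Polynomial.natDegree_det_X_add_C_le _ _)) (by simp; norm_cast; omega)),
      Lagrange.interpolate_apply]
    rw [Polynomial.eval_finsetSum]
    refine Finset.sum_congr rfl fun i _ => ?_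
    rw [hdet, Polynomial.eval_mul, Polynomial.eval_C, mul_comm]

variable {d : ℕ}

local notation "𝔼" => EuclideanSpace ℝ (Fin d)

theorem exists_mem_sphere_dist_le {E : Type*} [NormedAddCommGroup E] [NormedSpace ℝ E] {x y : E}
    (hx : ‖x‖ ≤ 1) (hy : 1 ≤ ‖y‖) : ∃ z : E, ‖z‖ = 1 ∧ ‖x - z‖ ≤ ‖x - y‖ := by
  have hc : ContinuousOn (fun s : ℝ => ‖x + s • (y - x)‖) (Icc 0 1) := by fun_prop
  obtain ⟨s, hs, h⟩ := intermediate_value_Icc zero_le_one hc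
    (show (1 : ℝ) ∈ Icc _ _ by simpa using ⟨hx, hy⟩)
  refine ⟨_, h, ?_⟩
  rw [sub_add_cancel_left, norm_neg, norm_smul, norm_sub_rev y x, Real.norm_of_nonneg hs.1]
  exact mul_le_of_le_one_left (norm_nonneg _) hs.2

/-- A map that is Lipschitz on the closed unit ball and vanishes on the unit sphere remains
Lipschitz when it is extended by zero. -/
theorem norm_indicator_sub_le {E : Type*} [NormedAddCommGroup E] [NormedSpace ℝ E] {u : E → E}
    {K : ℝ} (hK : 0 ≤ K) (hu : ∀ x ∈ closedBall (0 : E) 1, ∀ y ∈ closedBall (0 : E) 1,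
      ‖u x - u y‖ ≤ K * ‖x - y‖) (h0 : ∀ x, ‖x‖ = 1 → u x = 0) (x y : E) :
    ‖(closedBall (0 : E) 1).indicator u x - (closedBall (0 : E) 1).indicator u y‖ ≤
      K * ‖x - y‖ := by
  have key : ∀ x ∈ closedBall (0 : E) 1, ∀ y ∉ closedBall (0 : E) 1, ‖u x‖ ≤ K * ‖x - y‖ := by
    intro x hx y hy
    obtain ⟨z, hz, hxz⟩ := exists_mem_sphere_dist_le (x := x) (y := y) (by simpa using hx)
      (by simpa using (not_le.1 (by simpa using hy)).le)
    have := hu x hx z (by simp [hz])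
    rw [h0 z hz, sub_zero] at this
    exact this.trans (by gcongr)
  by_cases hx : x ∈ closedBall (0 : E) 1 <;> by_cases hy : y ∈ closedBall (0 : E) 1
  · simpa only [indicator_of_mem hx, indicator_of_mem hy] using hu x hx y hy
  · simpa only [indicator_of_mem hx, indicator_of_notMem hy, sub_zero] using key x hx y hy
  · rw [indicator_of_notMem hx, indicator_of_mem hy, zero_sub, norm_neg, norm_sub_rev]
    exact key y hy x hx
  · rw [indicator_of_notMem hx, indicator_of_notMem hy]
    simp; positivity

/-- A map of the unit ball to itself of the form `x ↦ x + s • u x`, where `u` is differentiable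
and vanishes on the sphere, is a bijection if `s` is small, so that its Jacobian determinant
integrates to the volume of the ball. -/
theorem integral_det_one_add_smul {u : 𝔼 → 𝔼} {K : ℝ} (hK : 0 ≤ K)
    (hu : ∀ x ∈ closedBall (0 : 𝔼) 1, ∀ y ∈ closedBall (0 : 𝔼) 1, ‖u x - u y‖ ≤ K * ‖x - y‖)
    (h0 : ∀ x, ‖x‖ = 1 → u x = 0) (hd : ∀ x ∈ ball (0 : 𝔼) 1, DifferentiableAt ℝ u x) {s : ℝ}
    (hs : |s| * K < 1) (hpos : ∀ x ∈ ball (0 : 𝔼) 1, 0 < (1 + s • fderiv ℝ u x).det) :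
    ∫ x in ball (0 : 𝔼) 1, (1 + s • fderiv ℝ u x).det = volume.real (ball (0 : 𝔼) 1) := by
  set v := (closedBall (0 : 𝔼) 1).indicator u with hv
  have hvL := norm_indicator_sub_le hK hu h0
  rw [← hv] at hvL
  let φ : 𝔼 → 𝔼 := fun x => x + s • v x
  obtain ⟨k, hk⟩ : ∃ k : NNReal, (k : ℝ) = |s| * K := ⟨⟨_, by positivity⟩, rfl⟩
  have happ : ApproximatesLinearOn φ (ContinuousLinearEquiv.refl ℝ 𝔼 : 𝔼 →L[ℝ] 𝔼) univ k := by
    intro x _ y _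
    have : φ x - φ y - (ContinuousLinearEquiv.refl ℝ 𝔼 : 𝔼 →L[ℝ] 𝔼) (x - y) =
        s • (v x - v y) := by
      simp only [φ, ContinuousLinearEquiv.coe_refl, ContinuousLinearMap.id_apply, smul_sub]
      abel
    rw [this, norm_smul, Real.norm_eq_abs, hk, mul_assoc]
    gcongr
    exact hvL x y
  have hc : Subsingleton 𝔼 ∨ k <
      ‖((ContinuousLinearEquiv.refl ℝ 𝔼).symm : 𝔼 →L[ℝ] 𝔼)‖₊⁻¹ := by
    rcases subsingleton_or_nontrivial 𝔼 with h | h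
    · exact Or.inl h
    · right
      rw [← NNReal.coe_lt_coe]
      simpa [hk] using hs
  have hinj : Function.Injective φ := by
    simpa [injOn_univ] using happ.injOn hc
  have hsurj : Function.Surjective φ := happ.surjective hc
  have hout : ∀ x, x ∉ ball (0 : 𝔼) 1 → φ x = x := by
    intro x hx
    have : v x = 0 := by
      by_cases h : x ∈ closedBall (0 : 𝔼) 1
      · rw [hv, indicator_of_mem h, h0]
        rw [mem_ball_zero_iff, not_lt] at hx
        rw [mem_closedBall_zero_iff] at h
        exact le_antisymm h hx
      · rw [hv, indicator_of_notMem h]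
    simp [φ, this]
  have himg : φ '' ball (0 : 𝔼) 1 = ball (0 : 𝔼) 1 := by
    ext y
    constructor
    · rintro ⟨x, hx, rfl⟩
      by_contra h
      exact h (by rwa [hinj (hout _ h)])
    · intro hy
      obtain ⟨x, rfl⟩ := hsurj y
      refine ⟨x, ?_, rfl⟩
      by_contra h
      rw [hout x h] at hy
      exact h hy
  have hder : ∀ x ∈ ball (0 : 𝔼) 1,
      HasFDerivWithinAt φ (1 + s • fderiv ℝ u x) (ball (0 : 𝔼) 1) x := by
    intro x hx
    have h1 : HasFDerivAt (fun x => x + s • u x) (1 + s • fderiv ℝ u x) x :=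
      (hasFDerivAt_id x).add ((hd x hx).hasFDerivAt.const_smul s)
    refine h1.hasFDerivWithinAt.congr (fun y hy => ?_) ?_ <;>
    simp only [φ, hv]
    · rw [indicator_of_mem (ball_subset_closedBall hy)]
    · rw [indicator_of_mem (ball_subset_closedBall hx)]
  have := integral_image_eq_integral_abs_det_fderiv_smul volume measurableSet_ball hder
    hinj.injOn (fun _ => (1 : ℝ))
  rw [himg] at this
  simp only [smul_eq_mul, mul_one, integral_const, measureReal_restrict_apply_univ] at this
  rw [this]
  exact setIntegral_congr_fun measurableSet_ball fun x hx => (abs_of_pos (hpos x hx)).symm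

/-- The integral of the Jacobian determinant of a `C¹` map that is the identity on the sphere:
as it is a polynomial in `s` along the homotopy `x ↦ x + s • (h x - x)` and constant for small `s`,
it is constant. -/
theorem integral_det_fderiv_of_eqOn_sphere {h : 𝔼 → 𝔼} {U : Set 𝔼} (hU : IsOpen U)
    (hBU : closedBall (0 : 𝔼) 1 ⊆ U) (hh : ContDiffOn ℝ 1 h U) (hid : ∀ x, ‖x‖ = 1 → h x = x) :
    ∫ x in ball (0 : 𝔼) 1, (fderiv ℝ h x).det = volume.real (ball (0 : 𝔼) 1) := by
  let u : 𝔼 → 𝔼 := fun x => h x - x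
  have hu : ContDiffOn ℝ 1 u U := hh.sub contDiffOn_id
  have hdiff : ∀ x ∈ closedBall (0 : 𝔼) 1, DifferentiableAt ℝ u x := fun x hx =>
    (hu.differentiableOn (by simp)).differentiableAt (hU.mem_nhds (hBU hx))
  have hcont : ContinuousOn (fderiv ℝ u) (closedBall (0 : 𝔼) 1) :=
    (hu.continuousOn_fderiv_of_isOpen hU le_rfl).mono hBU
  obtain ⟨K, hK⟩ := (isCompact_closedBall (0 : 𝔼) 1).exists_bound_of_continuousOn hcont
  have hK0 : 0 ≤ K := (norm_nonneg _).trans (hK 0 (by simp))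
  have hL : ∀ x ∈ closedBall (0 : 𝔼) 1, ∀ y ∈ closedBall (0 : 𝔼) 1,
      ‖u x - u y‖ ≤ K * ‖x - y‖ := fun x hx y hy =>
    (convex_closedBall (0 : 𝔼) 1).norm_image_sub_le_of_norm_fderiv_le hdiff hK hy hx
  have h0 : ∀ x, ‖x‖ = 1 → u x = 0 := fun x hx => by simp [u, hid x hx]
  have hfd : ∀ x ∈ closedBall (0 : 𝔼) 1, fderiv ℝ h x = 1 + fderiv ℝ u x := by
    intro x hx
    have h1 : h = fun x => x + u x := by funext x; simp [u]
    rw [h1]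
    exact ((hasFDerivAt_id x).add (hdiff x hx).hasFDerivAt).fderiv
  obtain ⟨δ, hδ, hδpos⟩ : ∃ δ > 0, ∀ A : 𝔼 →L[ℝ] 𝔼, ‖A‖ < δ → 0 < (1 + A).det := by
    have hc : ContinuousAt (fun A : 𝔼 →L[ℝ] 𝔼 => (1 + A).det) 0 :=
      (ContinuousLinearMap.continuous_det.comp (continuous_const.add continuous_id)).continuousAt
    have : ∀ᶠ A in nhds (0 : 𝔼 →L[ℝ] 𝔼), 0 < (1 + A).det := by
      refine hc.eventually (lt_mem_nhds ?_)
      simp [ContinuousLinearMap.det]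
    obtain ⟨δ, hδ, h⟩ := Metric.eventually_nhds_iff.1 this
    exact ⟨δ, hδ, fun A hA => h (by simpa using hA)⟩
  -- nodes `t i` with `t i * K < min 1 δ`
  set ε := min 1 δ / (K + 1) with hε
  have hε0 : 0 < ε := by positivity
  let t : ℕ → ℝ := fun i => ε / (i + 1)
  have htpos : ∀ i, 0 < t i := fun i => by positivity
  have htle : ∀ i, t i ≤ ε := fun i => div_le_self hε0.le (by simp)
  have hεK : ε * K < min 1 δ := by
    rw [hε, div_mul_eq_mul_div, div_lt_iff₀ (by positivity)]
    have : 0 < min 1 δ := by positivity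
    nlinarith
  have htK : ∀ i, t i * K < min 1 δ := fun i =>
    (mul_le_mul_of_nonneg_right (htle i) hK0).trans_lt hεK
  have ht : Function.Injective t := by
    intro i j hij
    simp only [t] at hij
    have h1 : (i : ℝ) + 1 ≠ 0 := by positivity
    have h2 : (j : ℝ) + 1 ≠ 0 := by positivity
    rw [div_eq_div_iff h1 h2, mul_right_inj' hε0.ne'] at hij
    exact_mod_cast (add_right_cancel hij).symm
  obtain ⟨N, c, hc, hdet⟩ := exists_det_one_add_eq_sum 𝔼 t ht
  have hint : ∀ i, IntegrableOn (fun x => (1 + t i • fderiv ℝ u x).det) (ball (0 : 𝔼) 1) := by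
    intro i
    refine IntegrableOn.mono_set (t := closedBall (0 : 𝔼) 1) ?_ ball_subset_closedBall
    refine ContinuousOn.integrableOn_compact (isCompact_closedBall _ _) ?_
    exact ContinuousLinearMap.continuous_det.comp_continuousOn
      (continuousOn_const.add (hcont.const_smul (t i)))
  calc ∫ x in ball (0 : 𝔼) 1, (fderiv ℝ h x).det
      = ∫ x in ball (0 : 𝔼) 1, ∑ i ∈ Finset.range N, c i * (1 + t i • fderiv ℝ u x).det := by
        refine setIntegral_congr_fun measurableSet_ball fun x hx => ?_
        rw [hfd x (ball_subset_closedBall hx), hdet]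
    _ = ∑ i ∈ Finset.range N, c i * volume.real (ball (0 : 𝔼) 1) := by
        rw [integral_finsetSum _ fun i _ => (hint i).const_mul (c i)]
        refine Finset.sum_congr rfl fun i _ => ?_
        rw [integral_const_mul, integral_det_one_add_smul hK0 hL h0
          (fun x hx => hdiff x (ball_subset_closedBall hx))]
        · rw [abs_of_pos (htpos i)]
          exact (htK i).trans_le (min_le_left _ _)
        · intro x hx
          refine hδpos _ ?_
          rw [norm_smul, Real.norm_of_nonneg (htpos i).le]
          exact (mul_le_mul_of_nonneg_left (hK x (ball_subset_closedBall hx))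
            (htpos i).le).trans_lt ((htK i).trans_le (min_le_right _ _))
    _ = volume.real (ball (0 : 𝔼) 1) := by rw [← Finset.sum_mul, hc, one_mul]

/-- There is no `C¹` retraction of the ball onto the sphere: its Jacobian determinant would vanish,
as the derivative maps into the orthogonal complement of the value. -/
theorem not_exists_contDiffOn_retraction {h : 𝔼 → 𝔼} {U : Set 𝔼} (hU : IsOpen U)
    (hBU : closedBall (0 : 𝔼) 1 ⊆ U) (hh : ContDiffOn ℝ 1 h U) (hid : ∀ x, ‖x‖ = 1 → h x = x)
    (hnorm : ∀ x ∈ U, ‖h x‖ = 1) : False := by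
  have hint := integral_det_fderiv_of_eqOn_sphere hU hBU hh hid
  have hzero : ∀ x ∈ ball (0 : 𝔼) 1, (fderiv ℝ h x).det = 0 := by
    intro x hx
    have hxU := hU.mem_nhds (hBU (ball_subset_closedBall hx))
    have hd : HasFDerivAt h (fderiv ℝ h x) x :=
      ((hh.differentiableOn (by simp)).differentiableAt hxU).hasFDerivAt
    have horth : ∀ w, inner ℝ (h x) (fderiv ℝ h x w) = 0 := by
      intro w
      have h1 := (hd.inner ℝ hd)
      have h2 : (fun y => inner ℝ (h y) (h y)) =ᶠ[nhds x] fun _ => (1 : ℝ) := by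
        filter_upwards [hxU] with y hy
        rw [real_inner_self_eq_norm_sq, hnorm y hy, one_pow]
      have h3 := (h2.hasFDerivAt_iff.1 h1).unique (hasFDerivAt_const (1 : ℝ) x)
      have h4 := congrArg (fun L => L w) h3
      simp [real_inner_comm] at h4
      linarith [real_inner_comm (h x) (fderiv ℝ h x w)]
    by_contra hne
    obtain ⟨w, hw⟩ := LinearMap.range_eq_top.1 ((LinearMap.isUnit_iff_range_eq_top _).1
      ((LinearMap.isUnit_iff_isUnit_det _).2 (isUnit_iff_ne_zero.2 hne))) (h x)
    have h5 := horth w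
    rw [ContinuousLinearMap.coe_coe] at hw
    rw [hw, real_inner_self_eq_norm_sq, hnorm x (mem_of_mem_nhds hxU)] at h5
    norm_num at h5
  rw [setIntegral_congr_fun measurableSet_ball hzero, integral_zero] at hint
  exact (ENNReal.toReal_pos (measure_ball_pos volume (0 : 𝔼) one_pos).ne'
    measure_ball_lt_top.ne).ne hint

/-- There is no continuous retraction of Euclidean space onto the unit sphere. -/
theorem not_exists_retraction_sphere {r : 𝔼 → 𝔼} (hr : Continuous r)
    (hid : ∀ x, ‖x‖ = 1 → r x = x) (hnorm : ∀ x, ‖r x‖ = 1) : False := by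
  -- The map `f` is radial outside the ball of radius `1 / 2`, hence smooth near the sphere.
  let f : 𝔼 → 𝔼 := fun x => r ((max (1 / 2) ‖x‖)⁻¹ • x)
  have hf : Continuous f := by
    refine hr.comp (Continuous.smul (Continuous.inv₀
      (continuous_const.max continuous_norm) fun x => ?_) continuous_id)
    exact (lt_of_lt_of_le (by norm_num) (le_max_left _ _)).ne'
  have hfr : ∀ x, 1 / 2 < ‖x‖ → f x = ‖x‖⁻¹ • x := by
    intro x hx
    have hx0 : ‖x‖ ≠ 0 := by linarith
    simp only [f, max_eq_right hx.le]
    exact hid _ (by rw [norm_smul, norm_inv, norm_norm, inv_mul_cancel₀ hx0])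
  have hopen : IsOpen {x : 𝔼 | 1 / 2 < ‖x‖} := isOpen_lt continuous_const continuous_norm
  have hsm : ContDiffOn ℝ (1 : ℕ∞) f {x : 𝔼 | 1 / 2 < ‖x‖} := by
    refine ContDiffOn.congr (f := fun x => ‖x‖⁻¹ • x) ?_ hfr
    intro x hx
    have hx0 : x ≠ 0 := by rintro rfl; norm_num at hx
    exact (((contDiffAt_norm ℝ hx0).inv (by simpa using hx0)).smul contDiffAt_id).contDiffWithinAt
  obtain ⟨g, hg, hgf, hgS, -⟩ := hf.exists_contDiff_approx_and_eqOn 1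
    (continuous_const (y := (1 : ℝ))) (fun _ => one_pos) (S := sphere (0 : 𝔼) 1) isClosed_sphere
    (hopen.mem_nhdsSet.2 fun x hx => by
      rw [mem_sphere_zero_iff_norm] at hx
      norm_num [hx]) hsm
  have hg0 : ∀ x, g x ≠ 0 := by
    intro x hx
    have := hgf x
    rw [hx, dist_zero_left] at this
    exact this.ne (hnorm _)
  refine not_exists_contDiffOn_retraction (h := fun x => ‖g x‖⁻¹ • g x) isOpen_univ
    (subset_univ _) (ContDiff.contDiffOn ?_) (fun x hx => ?_) fun x _ => ?_
  · exact ((hg.norm ℝ hg0).inv fun x => by simpa using hg0 x).smul hg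
  · rw [hgS (by simpa using hx), hfr x (by rw [hx]; norm_num), hx]
    simp [hx]
  · rw [norm_smul, norm_inv, norm_norm, inv_mul_cancel₀ (by simpa using hg0 x)]

theorem not_tietzeExtension_sphere : ¬ TietzeExtension.{0} (sphere (0 : 𝔼) 1) := by
  intro h
  obtain ⟨g, hg⟩ := ContinuousMap.exists_restrict_eq (isClosed_sphere (x := (0 : 𝔼)) (ε := 1))
    (ContinuousMap.id _)
  refine not_exists_retraction_sphere (r := fun x => (g x : 𝔼)) (by fun_prop) (fun x hx => ?_)
    fun x => by simp
  exact congrArg Subtype.val (DFunLike.congr_fun hg ⟨x, by simpa using hx⟩)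

end NoRetraction

/-! ### Gluing absolute extensors -/

section Gluing

open Set

theorem TietzeExtension.nonempty (Y : Type*) [TopologicalSpace Y] [TietzeExtension.{0} Y] :
    Nonempty Y := by
  obtain ⟨g, -⟩ := ContinuousMap.exists_restrict_eq (X := PUnit) isClosed_empty
    (⟨fun x => x.2.elim, continuous_of_discreteTopology⟩ : C((∅ : Set PUnit.{1}), Y))
  exact ⟨g PUnit.unit⟩

theorem TietzeExtension.exists_continuous_eqOn {X : Type} {M : Type*} [TopologicalSpace X]
    [NormalSpace X] [TopologicalSpace M] (T : Set M) [TietzeExtension.{0} T] {s : Set X}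
    (hs : IsClosed s) {F : X → M} (hF : ContinuousOn F s) (hT : ∀ x ∈ s, F x ∈ T) :
    ∃ G : X → M, Continuous G ∧ (∀ x, G x ∈ T) ∧ EqOn G F s := by
  obtain ⟨g, hg⟩ := ContinuousMap.exists_restrict_eq hs
    (⟨fun x => ⟨F x, hT x x.2⟩, hF.domRestrict.subtype_mk _⟩ : C(s, T))
  exact ⟨fun x => g x, by fun_prop, fun x => (g x).2, fun x hx =>
    congrArg Subtype.val (DFunLike.congr_fun hg ⟨x, hx⟩)⟩

/-- If two closed sets and their intersection have the Tietze extension property, then so does their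
union. The distances to the two sets give a separating function on the domain of the map to be
extended; the extension is built on its zero set first and then on either side of it. -/
theorem TietzeExtension.union {M : Type*} [PseudoMetricSpace M] {X₁ X₂ : Set M} (h₁ : IsClosed X₁)
    (h₂ : IsClosed X₂) [TietzeExtension.{0} X₁] [TietzeExtension.{0} X₂]
    [TietzeExtension.{0} ↥(X₁ ∩ X₂)] : TietzeExtension.{0} ↥(X₁ ∪ X₂) where
  exists_restrict_eq' {X} _ _ s hs f := by
    classical
    obtain ⟨m, hm₁, hm₂⟩ : (X₁ ∩ X₂).Nonempty :=
      nonempty_coe_sort.1 (TietzeExtension.nonempty ↥(X₁ ∩ X₂))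
    let F : X → M := fun x => if h : x ∈ s then f ⟨x, h⟩ else m
    have hFf : ∀ x (h : x ∈ s), F x = f ⟨x, h⟩ := fun x h => by simp [F, h]
    have hF : ContinuousOn F s := by
      rw [continuousOn_iff_continuous_domRestrict]
      have : s.domRestrict F = fun x => (f x : M) := funext fun x => hFf x x.2
      rw [this]
      fun_prop
    have hFX : ∀ x ∈ s, F x ∈ X₁ ∪ X₂ := fun x h => by rw [hFf x h]; exact (f ⟨x, h⟩).2
    have : TietzeExtension.{0} (univ : Set ℝ) := .of_homeo (Homeomorph.Set.univ ℝ)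
    obtain ⟨A, hA, -, hAs⟩ := TietzeExtension.exists_continuous_eqOn (M := ℝ) univ hs
      (F := fun x => Metric.infDist (F x) X₁ - Metric.infDist (F x) X₂)
      (((Metric.continuous_infDist_pt X₁).comp_continuousOn hF).sub
        ((Metric.continuous_infDist_pt X₂).comp_continuousOn hF)) (fun _ _ => mem_univ _)
    have hneg : ∀ x ∈ s, A x ≤ 0 → F x ∈ X₁ := by
      intro x hx h
      rw [hAs hx] at h
      refine (hFX x hx).elim id fun h' => (h₁.mem_iff_infDist_zero ⟨m, hm₁⟩).2 ?_
      simp only [Metric.infDist_zero_of_mem h'] at h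
      linarith [Metric.infDist_nonneg (x := F x) (s := X₁)]
    have hpos : ∀ x ∈ s, 0 ≤ A x → F x ∈ X₂ := by
      intro x hx h
      rw [hAs hx] at h
      refine (hFX x hx).elim (fun h' => (h₂.mem_iff_infDist_zero ⟨m, hm₂⟩).2 ?_) id
      simp only [Metric.infDist_zero_of_mem h'] at h
      linarith [Metric.infDist_nonneg (x := F x) (s := X₂)]
    have hZ : IsClosed {x | A x = 0} := isClosed_eq hA continuous_const
    obtain ⟨G₀, hG₀, hG₀X, hG₀F⟩ := TietzeExtension.exists_continuous_eqOn (X₁ ∩ X₂)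
      (hs.inter hZ) (hF.mono inter_subset_left)
      (fun x hx => ⟨hneg x hx.1 (le_of_eq hx.2), hpos x hx.1 (le_of_eq hx.2.symm)⟩)
    have step : ∀ (Y : Set M) [TietzeExtension.{0} Y], IsClosed Y → X₁ ∩ X₂ ⊆ Y →
        ∃ G : X → M, Continuous G ∧ (∀ x, G x ∈ Y) ∧ (∀ x ∈ s, F x ∈ Y → G x = F x) ∧
          ∀ x, A x = 0 → G x = G₀ x := by
      intro Y _ hY hXY
      have e1 : EqOn (s.piecewise F G₀) F (s ∩ F ⁻¹' Y) := fun x hx =>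
        piecewise_eq_of_mem _ _ _ hx.1
      have e2 : EqOn (s.piecewise F G₀) G₀ {x | A x = 0} := by
        intro x hx
        by_cases h : x ∈ s
        · rw [piecewise_eq_of_mem _ _ _ h, hG₀F ⟨h, hx⟩]
        · rw [piecewise_eq_of_notMem _ _ _ h]
      have hc : IsClosed (s ∩ F ⁻¹' Y) := hF.preimage_isClosed_of_isClosed hs hY
      obtain ⟨G, hG, hGY, hGF⟩ := TietzeExtension.exists_continuous_eqOn Y (hc.union hZ)
        (((hF.mono inter_subset_left).congr e1).union_of_isClosed
          (hG₀.continuousOn.congr e2) hc hZ) (by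
            rintro x (hx | hx)
            · rw [e1 hx]; exact hx.2
            · rw [e2 hx]; exact hXY (hG₀X x))
      exact ⟨G, hG, hGY, fun x hx hxY => (hGF (Or.inl ⟨hx, hxY⟩)).trans (e1 ⟨hx, hxY⟩),
        fun x hx => (hGF (Or.inr hx)).trans (e2 hx)⟩
    obtain ⟨G₁, hG₁, hG₁X, hG₁F, hG₁0⟩ := step X₁ h₁ inter_subset_left
    obtain ⟨G₂, hG₂, hG₂X, hG₂F, hG₂0⟩ := step X₂ h₂ inter_subset_right
    have hG : Continuous fun x => if A x ≤ 0 then G₁ x else G₂ x :=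
      Continuous.if_le hG₁ hG₂ hA continuous_const fun x hx => by rw [hG₁0 x hx, hG₂0 x hx]
    have hGX : ∀ x, (if A x ≤ 0 then G₁ x else G₂ x) ∈ X₁ ∪ X₂ := by
      intro x
      split_ifs
      · exact Or.inl (hG₁X x)
      · exact Or.inr (hG₂X x)
    refine ⟨⟨fun x => ⟨_, hGX x⟩, hG.subtype_mk hGX⟩, ?_⟩
    ext ⟨x, hx⟩
    rw [← hFf x hx]
    change (if A x ≤ 0 then G₁ x else G₂ x) = F x
    split_ifs with h
    · exact hG₁F x hx (hneg x hx h)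
    · exact hG₂F x hx (hpos x hx (not_le.1 h).le)

end Gluing

/-! ### Realizations with the Tietze extension property -/

namespace SimplicialCx

variable {V : Type*} [Fintype V] [DecidableEq V]

theorem mem_convexHull_single_image {I : Finset V} {p : V → ℝ} :
    p ∈ convexHull ℝ ((fun i : V => (Pi.single i 1 : V → ℝ)) '' (I : Set V)) ↔
      (∀ i, 0 ≤ p i) ∧ ∑ i, p i = 1 ∧ ∀ i, p i ≠ 0 → i ∈ I := by
  constructor
  · intro hp
    refine convexHull_min (t := {p : V → ℝ | (∀ i, 0 ≤ p i) ∧ ∑ i, p i = 1 ∧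
      ∀ i, p i ≠ 0 → i ∈ I}) ?_ ?_ hp
    · rintro _ ⟨j, hj, rfl⟩
      refine ⟨fun i => ?_, by simp, fun i hi => ?_⟩
      · by_cases h : i = j
        · subst h; simp
        · simp [Pi.single_eq_of_ne h]
      · by_cases h : i = j
        · subst h; exact hj
        · exact (hi (Pi.single_eq_of_ne h 1)).elim
    · rintro p ⟨hp0, hp1, hpI⟩ q ⟨hq0, hq1, hqI⟩ a b ha hb hab
      refine ⟨fun i => ?_, ?_, fun i hi => ?_⟩
      · have := hp0 i
        have := hq0 i
        simp only [Pi.add_apply, Pi.smul_apply, smul_eq_mul]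
        positivity
      · simp [Finset.sum_add_distrib, ← Finset.mul_sum, hp1, hq1, hab]
      · by_contra h
        exact hi (by simp [not_not.1 (mt (hpI i) h), not_not.1 (mt (hqI i) h)])
  · rintro ⟨h0, h1, hI⟩
    have hp : p = ∑ i ∈ I, p i • (Pi.single i 1 : V → ℝ) := by
      ext j
      simp only [Finset.sum_apply, Pi.smul_apply, smul_eq_mul, Pi.single_apply, mul_ite, mul_one,
        mul_zero, Finset.sum_ite_eq]
      split_ifs with h
      · rfl
      · exact not_not.1 (mt (hI j) h)
    rw [hp]
    refine (convex_convexHull ℝ _).sum_mem (fun i _ => h0 i) ?_ fun i hi =>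
      subset_convexHull _ _ ⟨i, hi, rfl⟩
    rw [← h1]
    exact Finset.sum_subset (Finset.subset_univ I) fun i _ hi => not_not.1 (mt (hI i) hi)

theorem mem_realization {Δ : SimplicialCx V} {p : V → ℝ} :
    p ∈ Δ.realization ↔
      (∀ i, 0 ≤ p i) ∧ ∑ i, p i = 1 ∧ (Finset.univ.filter fun i => p i ≠ 0) ∈ Δ := by
  simp only [realization, Set.mem_iUnion, mem_convexHull_single_image]
  constructor
  · rintro ⟨I, hI, h0, h1, h⟩
    exact ⟨h0, h1, Δ.lower (fun i hi => h i (by simpa using hi)) hI⟩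
  · rintro ⟨h0, h1, h⟩
    exact ⟨_, h, h0, h1, fun i hi => by simpa using hi⟩

theorem realization_sup (Δ Γ : SimplicialCx V) :
    (Δ ⊔ Γ).realization = Δ.realization ∪ Γ.realization := by
  ext p
  simp only [Set.mem_union, mem_realization, LowerSet.mem_sup_iff]
  tauto

theorem realization_inf (Δ Γ : SimplicialCx V) :
    (Δ ⊓ Γ).realization = Δ.realization ∩ Γ.realization := by
  ext p
  simp only [Set.mem_inter_iff, mem_realization, LowerSet.mem_inf_iff]
  tauto

theorem isClosed_realization (Δ : SimplicialCx V) : IsClosed Δ.realization :=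
  Set.Finite.isClosed_biUnion (Set.toFinite (Δ : Set (Finset V))) fun I _ =>
    ((I.finite_toSet.image _).isCompact_convexHull ℝ).isClosed

theorem tietzeExtension_realization_sup {Δ Γ : SimplicialCx V}
    (hΔ : TietzeExtension.{0} Δ.realization) (hΓ : TietzeExtension.{0} Γ.realization)
    (h : TietzeExtension.{0} (Δ ⊓ Γ).realization) : TietzeExtension.{0} (Δ ⊔ Γ).realization := by
  rw [realization_inf] at h
  rw [realization_sup]
  exact TietzeExtension.union Δ.isClosed_realization Γ.isClosed_realization

/-- The full simplex on a finite set `I`. -/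
def fullSimplex (I : Finset V) : SimplicialCx V := LowerSet.Iic I

omit [Fintype V] [DecidableEq V] in
theorem mem_fullSimplex {I J : Finset V} : J ∈ fullSimplex I ↔ J ⊆ I := Iff.rfl

theorem tietzeExtension_realization_fullSimplex {I : Finset V} (hI : I.Nonempty) :
    TietzeExtension.{0} (fullSimplex I).realization := by
  obtain ⟨i₀, hi₀⟩ := hI
  have hmem : ∀ p : V → ℝ, p ∈ (fullSimplex I).realization ↔
      (∀ i, 0 ≤ p i) ∧ ∑ i, p i = 1 ∧ ∀ i, p i ≠ 0 → i ∈ I := by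
    intro p
    rw [mem_realization, mem_fullSimplex]
    simp [Finset.subset_iff]
  -- A retraction onto the simplex: take positive parts, divide by the sum if it exceeds `1`, and
  -- make up for a sum below `1` at the vertex `i₀`.
  let g : (V → ℝ) → V → ℝ := fun p i => if i ∈ I then max (p i) 0 else 0
  let S : (V → ℝ) → ℝ := fun p => ∑ i, g p i
  let ρ : (V → ℝ) → V → ℝ := fun p i =>
    g p i / max 1 (S p) + if i = i₀ then 1 - S p / max 1 (S p) else 0
  have hgc : ∀ i, Continuous fun p => g p i := by
    intro i
    by_cases h : i ∈ I
    · simp only [g, h, if_true]; fun_prop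
    · simp only [g, h, if_false]; fun_prop
  have hSc : Continuous S := continuous_finsetSum _ fun i _ => hgc i
  have hM : ∀ p, 0 < max 1 (S p) := fun p => lt_of_lt_of_le one_pos (le_max_left _ _)
  have hg0 : ∀ p i, 0 ≤ g p i := by
    intro p i; simp only [g]; split_ifs <;> simp
  have hρc : Continuous ρ := by
    refine continuous_pi fun i => ?_
    by_cases h : i = i₀
    · simp only [ρ, h, if_true]
      exact ((hgc i₀).div (continuous_const.max hSc) fun p => (hM p).ne').add
        (continuous_const.sub (hSc.div (continuous_const.max hSc) fun p => (hM p).ne'))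
    · simp only [ρ, h, if_false, add_zero]
      exact (hgc i).div (continuous_const.max hSc) fun p => (hM p).ne'
  have hρ : ∀ p, ρ p ∈ (fullSimplex I).realization := by
    intro p
    rw [hmem]
    refine ⟨fun i => ?_, ?_, fun i hi => ?_⟩
    · refine add_nonneg (div_nonneg (hg0 p i) (hM p).le) ?_
      split_ifs
      · rw [sub_nonneg, div_le_one (hM p)]; exact le_max_right _ _
      · exact le_rfl
    · simp only [ρ, Finset.sum_add_distrib, ← Finset.sum_div, Finset.sum_ite_eq',
        Finset.mem_univ, if_true]
      change S p / _ + _ = 1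
      ring
    · by_contra h
      have : i ≠ i₀ := fun e => h (e ▸ hi₀)
      exact hi (by simp [ρ, g, h, this])
  refine TietzeExtension.of_retract (Z := V → ℝ) ⟨Subtype.val, continuous_subtype_val⟩
    ⟨fun p => ⟨ρ p, hρ p⟩, hρc.subtype_mk _⟩ ?_
  ext ⟨p, hp⟩ i
  obtain ⟨h0, h1, hI⟩ := (hmem p).1 hp
  have hg : g p = p := by
    ext i
    simp only [g]
    split_ifs with h
    · exact max_eq_left (h0 i)
    · exact (not_not.1 (mt (hI i) h)).symm
  have hS : S p = 1 := by simp only [S, hg, h1]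
  change ρ p i = p i
  simp [ρ, hg, hS]

/-- The complex generated by a finite family of sets. -/
def generatedBy (K : Finset (Finset V)) : SimplicialCx V where
  carrier := {J | ∃ F ∈ K, J ⊆ F}
  lower' := fun _ _ hba ⟨F, hF, haF⟩ => ⟨F, hF, Finset.Subset.trans hba haF⟩

omit [Fintype V] [DecidableEq V] in
theorem mem_generatedBy {K : Finset (Finset V)} {J : Finset V} :
    J ∈ generatedBy K ↔ ∃ F ∈ K, J ⊆ F := Iff.rfl

/-- Induction on the number of generators, one simplex being glued on at a time: the part along
which it is glued has fewer generators, and they contain `v` as well. -/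
theorem tietzeExtension_realization_generatedBy {K : Finset (Finset V)} (hK : K.Nonempty) {v : V}
    (hv : ∀ F ∈ K, v ∈ F) : TietzeExtension.{0} (generatedBy K).realization := by
  induction hn : K.card using Nat.strong_induction_on generalizing K with
  | _ n ih =>
    obtain ⟨F, hF⟩ := hK
    by_cases hK' : (K.erase F).Nonempty
    · have hcard : (K.erase F).card < n := hn ▸ Finset.card_erase_lt_of_mem hF
      have h1 := ih _ hcard hK' (fun G hG => hv G (Finset.mem_of_mem_erase hG)) rfl
      have h2 := tietzeExtension_realization_fullSimplex ⟨v, hv F hF⟩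
      have h3 := ih _ (Finset.card_image_le.trans_lt hcard) (hK'.image (· ∩ F)) (by
        intro G hG
        obtain ⟨G', hG', rfl⟩ := Finset.mem_image.1 hG
        exact Finset.mem_inter.2 ⟨hv G' (Finset.mem_of_mem_erase hG'), hv F hF⟩) rfl
      have e1 : generatedBy K = generatedBy (K.erase F) ⊔ fullSimplex F := by
        ext J
        rw [SetLike.mem_coe, SetLike.mem_coe, LowerSet.mem_sup_iff, mem_generatedBy,
          mem_generatedBy, mem_fullSimplex]
        constructor
        · rintro ⟨G, hG, hJ⟩
          by_cases h : G = F
          · exact Or.inr (h ▸ hJ)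
          · exact Or.inl ⟨G, Finset.mem_erase.2 ⟨h, hG⟩, hJ⟩
        · rintro (⟨G, hG, hJ⟩ | hJ)
          · exact ⟨G, Finset.mem_of_mem_erase hG, hJ⟩
          · exact ⟨F, hF, hJ⟩
      have e2 : generatedBy ((K.erase F).image (· ∩ F)) =
          generatedBy (K.erase F) ⊓ fullSimplex F := by
        ext J
        rw [SetLike.mem_coe, SetLike.mem_coe, LowerSet.mem_inf_iff, mem_generatedBy,
          mem_generatedBy, mem_fullSimplex]
        constructor
        · rintro ⟨G, hG, hJ⟩
          obtain ⟨G', hG', rfl⟩ := Finset.mem_image.1 hG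
          exact ⟨⟨G', hG', hJ.trans Finset.inter_subset_left⟩, hJ.trans Finset.inter_subset_right⟩
        · rintro ⟨⟨G, hG, hJ⟩, hJF⟩
          exact ⟨G ∩ F, Finset.mem_image_of_mem _ hG, Finset.subset_inter hJ hJF⟩
      rw [e2] at h3
      rw [e1]
      exact tietzeExtension_realization_sup h1 h2 h3
    · have : K = {F} := by
        rw [Finset.not_nonempty_iff_eq_empty, Finset.erase_eq_empty_iff] at hK'
        exact hK'.resolve_left (Finset.ne_empty_of_mem hF)
      have e : generatedBy K = fullSimplex F := by
        ext J
        rw [SetLike.mem_coe, SetLike.mem_coe, mem_generatedBy, mem_fullSimplex, this]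
        simp
      rw [e]
      exact tietzeExtension_realization_fullSimplex ⟨v, hv F hF⟩

theorem tietzeExtension_realization_cone {Δ : SimplicialCx V} {v : V} (hne : ∃ J, J ∈ Δ)
    (hv : ∀ J ∈ Δ, insert v J ∈ Δ) : TietzeExtension.{0} Δ.realization := by
  classical
  obtain ⟨J, hJ⟩ := hne
  have e : Δ = generatedBy (Finset.univ.filter fun F => F ∈ Δ ∧ v ∈ F) := by
    ext J
    rw [SetLike.mem_coe, SetLike.mem_coe, mem_generatedBy]
    constructor
    · intro hJ
      exact ⟨insert v J, by simpa using hv J hJ, Finset.subset_insert v J⟩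
    · rintro ⟨F, hF, hJF⟩
      exact Δ.lower hJF (Finset.mem_filter.1 hF).2.1
  rw [e]
  exact tietzeExtension_realization_generatedBy (v := v) ⟨insert v J, by simpa using hv J hJ⟩
    fun F hF => (Finset.mem_filter.1 hF).2.2

end SimplicialCx

/-! ### Sphericity and the Demazure product -/

section Spherical

open CoxeterSystem

/-- Unless `x` is the Demazure product of the word, the realization of a subword complex has the
Tietze extension property: if the first letter is not the apex of a cone, the complex is the union
of its deletion and of the cone over its link. -/
theorem tietzeExtension_realization_listComplex {V B W : Type*} [Fintype V] [DecidableEq V]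
    [Group W] {M : CoxeterMatrix B} {cs : CoxeterSystem M W} {Q : V → B} {L : List V}
    (hL : L.Nodup) {x : W} (hx : cs.WordContains (L.map Q) x)
    (hne : cs.demazureProd (L.map Q) ≠ x) :
    TietzeExtension.{0} (listComplex cs Q L x).realization := by
  have hempty : ∀ (L : List V) (x : W), cs.WordContains (L.map Q) x →
      ∅ ∈ listComplex cs Q L x := fun L x hx => mem_listComplex.2 ⟨by simp, by simpa using hx⟩
  induction L generalizing x with
  | nil => exact (hne (by simpa using (wordContains_nil.1 hx).symm)).elim
  | cons v L ih =>
    obtain ⟨hv, hL⟩ := List.nodup_cons.1 hL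
    by_cases hlt : cs.length (cs.simple (Q v) * x) < cs.length x
    · rw [List.map_cons, wordContains_cons_of_lt hlt] at hx
      have hup : cs.simpleDemazure (Q v) (cs.simple (Q v) * x) = x := by
        rw [simpleDemazure, simple_mul_simple_cancel_left, if_neg hlt.not_gt]
      have hdel := ih hL hx fun h => hne (by rw [List.map_cons, demazureProd_cons, h, hup])
      have hJ : ∀ J, J ∈ listComplex cs Q (v :: L) x →
          v ∉ J → J ∈ listComplex cs Q L (cs.simple (Q v) * x) := by
        intro J hJ hvJ
        rw [← deletion_listComplex_cons_of_lt hv hlt]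
        exact SimplicialCx.mem_deletion_singleton.2 ⟨hJ, hvJ⟩
      have hsub : ∀ J, J ∈ listComplex cs Q L (cs.simple (Q v) * x) →
          J ∈ listComplex cs Q (v :: L) x ∧ v ∉ J := by
        intro J hJ
        rw [← deletion_listComplex_cons_of_lt hv hlt] at hJ
        exact SimplicialCx.mem_deletion_singleton.1 hJ
      have hlk : ∀ J, J ∈ listComplex cs Q L x ↔
          insert v J ∈ listComplex cs Q (v :: L) x ∧ v ∉ J := by
        intro J
        rw [← link_listComplex_cons hv, SimplicialCx.mem_link_singleton]
      by_cases hxL : cs.WordContains (L.map Q) x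
      · have hlink := ih hL hxL fun h => hne (by
          rw [List.map_cons, demazureProd_cons, h, simpleDemazure, if_pos hlt])
        let Γ : SimplicialCx V :=
          { carrier := {J | insert v J ∈ listComplex cs Q (v :: L) x}
            lower' := fun _ _ hba ha =>
              (listComplex cs Q (v :: L) x).lower (Finset.insert_subset_insert v hba) ha }
        have hΓ : ∀ J, J ∈ Γ ↔ insert v J ∈ listComplex cs Q (v :: L) x := fun _ => Iff.rfl
        have hcone : TietzeExtension.{0} Γ.realization :=
          SimplicialCx.tietzeExtension_realization_cone (v := v)
            ⟨∅, (hΓ _).2 ((hlk ∅).1 (hempty L x hxL)).1⟩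
            fun J hJ => by rw [hΓ] at hJ ⊢; simpa using hJ
        have e1 : listComplex cs Q (v :: L) x =
            listComplex cs Q L (cs.simple (Q v) * x) ⊔ Γ := by
          ext J
          rw [SetLike.mem_coe, SetLike.mem_coe, LowerSet.mem_sup_iff, hΓ]
          constructor
          · intro h
            by_cases hvJ : v ∈ J
            · right; rwa [Finset.insert_eq_of_mem hvJ]
            · exact Or.inl (hJ J h hvJ)
          · rintro (h | h)
            · exact (hsub J h).1
            · exact (listComplex cs Q (v :: L) x).lower (Finset.subset_insert v J) h
        have e2 : listComplex cs Q L x = listComplex cs Q L (cs.simple (Q v) * x) ⊓ Γ := by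
          ext J
          rw [SetLike.mem_coe, SetLike.mem_coe, LowerSet.mem_inf_iff, hΓ, hlk]
          exact ⟨fun h => ⟨hJ J ((listComplex cs Q (v :: L) x).lower
            (Finset.subset_insert v J) h.1) h.2, h.1⟩, fun h => ⟨h.2, (hsub J h.1).2⟩⟩
        rw [e2] at hlink
        rw [e1]
        exact SimplicialCx.tietzeExtension_realization_sup hdel hcone hlink
      · have e : listComplex cs Q (v :: L) x = listComplex cs Q L (cs.simple (Q v) * x) := by
          ext J
          refine ⟨fun h => hJ J h fun hvJ => hxL ?_, fun h => (hsub J h).1⟩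
          have : J.erase v ∈ listComplex cs Q L x :=
            (hlk _).2 ⟨by rwa [Finset.insert_erase hvJ], by simp⟩
          exact (mem_listComplex.1 this).2.mono (restWord_sublist Q L _)
        rw [e]
        exact hdel
    · exact SimplicialCx.tietzeExtension_realization_cone ⟨∅, hempty _ x hx⟩
        fun J => insert_mem_listComplex_cons hv hlt

end Spherical

theorem mainTheorem4 {B W : Type*} [Group W] [Finite W] {M : CoxeterMatrix B}
    (cs : CoxeterSystem M W) {r : ℕ} (Q : Fin r → B) (x : W)
    (hsph : (subwordComplex cs Q x).IsSpherical)
    (I : Finset (Fin r)) (hI : I ∈ subwordComplex cs Q x) (hne : I.Nonempty) :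
    ((subwordComplex cs Q x).costar I).VertexDecomposable := by
  have hL := List.nodup_finRange r
  rw [subwordComplex_eq_listComplex] at hsph hI ⊢
  have hx : cs.demazureProd ((List.finRange r).map Q) = x := by
    by_contra h
    obtain ⟨d, ⟨e⟩⟩ := hsph
    have := tietzeExtension_realization_listComplex hL
      ((mem_listComplex.1 hI).2.mono (restWord_sublist Q _ I)) h
    exact not_tietzeExtension_sphere (TietzeExtension.of_homeo e.symm)
  have hdel := pureVertexDecomposable_deletion_listComplex hL hx hI hne
  rw [SimplicialCx.costar_eq_deletion (pureVertexDecomposable_listComplex hL x).2 hdel.2]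
  exact hdel.1
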